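/- **Theorem 2.1.** For $0<h\le r$ let $$\Omega(r,h)=\{(\xi,\eta)\in\mathbb R^2 : |\xi|+|\eta|\le r,\ -h<\eta\le h\}.$$ Besides $(\xi,\eta)$ use the coordinates $x=\eta+\xi$, $y=\eta-\xi$, so that $\partial_x=\tfrac12(\partial_\eta+\partial_\xi)$ and $\partial_y=\tfrac12(\partial_\eta-\partial_\xi)$. A map on a set that is not open is called smooth (analytic) if it extends to a smooth (real-analytic) map near each point of the set. A smooth map $F:\Omega(r,h)\to\mathbb R^3$ whose derivatives $F_x$, $F_y$ vanish nowhere is an *isothermic surface* if there is a function $u:\Omega(r,h)\to\mathbb R$ with $$\|F_x\|^2=\|F_y\|^2=e^{2u},\qquad \langle F_x,F_y\rangle=0,$$ and if $\langle F_{xy},N\rangle=0$ on $\Omega(r,h)$, where $N=\dfrac{F_x\times F_y}{\|F_x\times F_y\|}$ is its normal map. Let $r>0$, let $f:[-r,r]\to\mathbb R^3$ be an analytic curve that is regular, that is $f'(\xi)\neq0$ for all $\xi\in[-r,r]$, and let $n:[-r,r]\to\mathbb S^2$ be an analytic unit vector field along $f$ that is normal to it, that is $\langle f',n\rangle\equiv0$.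 Then for some $h$ with $0<h\le r$ there exists a unique analytic isothermic surface $F:\Omega(r,h)\to\mathbb R^3$ such that $$F(\xi,0)=f(\xi),\qquad N(\xi,0)=n(\xi)\qquad\text{for all }\xi\in(-r,r).$$ -/

import Mathlib

open scoped Matrix ContDiff

noncomputable section

/-- Euclidean three-space. -/
abbrev E3 : Type := EuclideanSpace ℝ (Fin 3)

/-- The domain `Ω(r,h)`, in the basic coordinates `p = (ξ, η)`. -/
def Dom (r h : ℝ) : Set (ℝ × ℝ) :=
  {p | |p.1| + |p.2| ≤ r ∧ -h < p.2 ∧ p.2 ≤ h}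

/-- The partial derivative `∂_x`, where `x = η + ξ`, `y = η - ξ`, that is
`ξ = (x - y) / 2`, `η = (x + y) / 2`. Functions are written in the coordinates `(ξ, η)`, so
`∂_x` is the derivative in the direction `(1/2, 1/2)`. -/
def dX (F : ℝ × ℝ → E3) (p : ℝ × ℝ) : E3 := fderiv ℝ F p (1 / 2, 1 / 2)

/-- The partial derivative `∂_y` (derivative in the direction `(-1/2, 1/2)` of the
`(ξ, η)`-plane). -/
def dY (F : ℝ × ℝ → E3) (p : ℝ × ℝ) : E3 := fderiv ℝ F p (-1 / 2, 1 / 2)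

/-- The cross product of Euclidean three-space. -/
def cross (a b : E3) : E3 := WithLp.toLp 2 (crossProduct a.ofLp b.ofLp)

/-- The normal map `N = (F_x × F_y) / ‖F_x × F_y‖`. -/
def normalMap (F : ℝ × ℝ → E3) (p : ℝ × ℝ) : E3 :=
  ‖cross (dX F p) (dY F p)‖⁻¹ • cross (dX F p) (dY F p)

/-- `F` is a parametrized surface on `Ω(r,h)`: smooth, with `F_x` and `F_y` vanishing nowhere.
Only the behaviour of `F` near `Ω(r,h)` matters; smoothness on the domain, which is not open,
means smoothness near each of its points. -/
structure IsSurface (r h : ℝ) (F : ℝ × ℝ → E3) : Prop where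
  smooth : ∀ p ∈ Dom r h, ContDiffAt ℝ ∞ F p
  dX_ne_zero : ∀ p ∈ Dom r h, dX F p ≠ 0
  dY_ne_zero : ∀ p ∈ Dom r h, dY F p ≠ 0

/-- `F` is a parametrized isothermic surface on `Ω(r,h)`: a conformal parametrization along
curvature lines. -/
structure IsIsothermic (r h : ℝ) (F : ℝ × ℝ → E3) : Prop extends IsSurface r h F where
  conformal : ∃ u : ℝ × ℝ → ℝ, ∀ p ∈ Dom r h,
    ‖dX F p‖ ^ 2 = Real.exp (2 * u p) ∧ ‖dY F p‖ ^ 2 = Real.exp (2 * u p) ∧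
      inner ℝ (dX F p) (dY F p) = 0
  curvatureLine : ∀ p ∈ Dom r h, inner ℝ (dY (dX F) p) (normalMap F p) = 0

/-- `F` is an analytic isothermic surface on `Ω(r,h)` with `F(ξ,0) = f(ξ)` and `N(ξ,0) = n(ξ)`
for all `ξ ∈ (-r,r)`. -/
structure IsBjorlingSolution (r h : ℝ) (f n : ℝ → E3) (F : ℝ × ℝ → E3) : Prop where
  analytic : AnalyticOnNhd ℝ F (Dom r h)
  isothermic : IsIsothermic r h F
  curve_eq : ∀ ξ ∈ Set.Ioo (-r) r, F (ξ, 0) = f ξ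
  normal_eq : ∀ ξ ∈ Set.Ioo (-r) r, normalMap F (ξ, 0) = n ξ

end

/-!
In the coordinates `(ξ, η)` an isothermic surface is a conformal map for which, moreover, `F_ξξ` and
`F_ηη` have the same normal component. Both halves of the theorem come from this reformulation as
an analytic Cauchy problem with data on the noncharacteristic line `η = 0`.

Uniqueness. Differentiation of the conformality relations gives
`|F_ξ| ^ 4 (F_ηη + F_ξξ) = 2 ⟨F_ξξ, ν⟩ ν` with `ν = F_ξ × F_η` (`IsIsothermic.isothermicPDE`), and
the data `f, n` determine `F` and `F_η` on the axis (`IsIsothermic.smul_dEta`). Two solutions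
therefore agree to every order in `η` along the axis; the bookkeeping is done with the notion
`Flat S k` of functions vanishing to order `k` on the axis, which is preserved by `∂_ξ` and by
products. By analyticity they agree near the origin, hence on the convex set `Ω(r, h)`.

Existence. The equation for `F` is quasilinear, but in terms of the conformal factor `g`, its
logarithmic derivatives `p, q`, the second fundamental form `g * (l, m, l)` and the orthonormal
frame `e₁, e₂, N` the `η`-derivatives are given by the system `IsStructureSystem`, which is
semilinear with constant coefficients and quadratic in the unknowns. For such systems the
Cauchy–Kovalevskaya theorem (`exists_analytic_solution`) has a short proof: the majorant
`1 / (1 - R ξ - T η)` reproduces itself under the recursion for the Taylor coefficients. The bounds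
are uniform for `ξ` in a compact interval, so the solution lives on a box over an interval
larger than `[-r, r]`, which contains `Ω(r, h)` for small `h`, corners included. The
`η`-derivatives alone are imposed; the remaining structure equations (orthonormality of the frame
and the `ξ`-derivatives) hold on the axis, and the deviations from them satisfy linear homogeneous
systems in `η` (`eq_zero_of_skew_system`, `eq_zero_of_dEta_eq_smul`), so they hold everywhere.
-/

noncomputable section

/-! ### Partial derivatives and flat functions -/

section PartialDerivatives

variable {V W X : Type*} [NormedAddCommGroup V] [NormedSpace ℝ V]
  [NormedAddCommGroup W] [NormedSpace ℝ W] [NormedAddCommGroup X] [NormedSpace ℝ X]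

/-- The partial derivative `∂_ξ`. -/
def dXi (H : ℝ × ℝ → V) (p : ℝ × ℝ) : V := fderiv ℝ H p (1, 0)

/-- The partial derivative `∂_η`. -/
def dEta (H : ℝ × ℝ → V) (p : ℝ × ℝ) : V := fderiv ℝ H p (0, 1)

/-- The open box `(-a, a) × (-b, b)` of the `(ξ, η)`-plane. -/
def Box (a b : ℝ) : Set (ℝ × ℝ) := Set.Ioo (-a) a ×ˢ Set.Ioo (-b) b

theorem isOpen_Box (a b : ℝ) : IsOpen (Box a b) := isOpen_Ioo.prod isOpen_Ioo

theorem AnalyticAt.dXi [CompleteSpace V] {H : ℝ × ℝ → V} {p : ℝ × ℝ} (h : AnalyticAt ℝ H p) :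
    AnalyticAt ℝ (dXi H) p :=
  (ContinuousLinearMap.apply ℝ V ((1, 0) : ℝ × ℝ)).analyticAt _ |>.comp h.fderiv

theorem AnalyticAt.dEta [CompleteSpace V] {H : ℝ × ℝ → V} {p : ℝ × ℝ} (h : AnalyticAt ℝ H p) :
    AnalyticAt ℝ (dEta H) p :=
  (ContinuousLinearMap.apply ℝ V ((0, 1) : ℝ × ℝ)).analyticAt _ |>.comp h.fderiv

theorem AnalyticOnNhd.dXi [CompleteSpace V] {H : ℝ × ℝ → V} {S : Set (ℝ × ℝ)}
    (h : AnalyticOnNhd ℝ H S) : AnalyticOnNhd ℝ (dXi H) S := fun p hp => (h p hp).dXi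

theorem AnalyticOnNhd.dEta [CompleteSpace V] {H : ℝ × ℝ → V} {S : Set (ℝ × ℝ)}
    (h : AnalyticOnNhd ℝ H S) : AnalyticOnNhd ℝ (dEta H) S := fun p hp => (h p hp).dEta

theorem AnalyticOnNhd.bilin {E : Type*} [NormedAddCommGroup E] [NormedSpace ℝ E] {B : V × W → X}
    {H : E → V} {K : E → W} {S : Set E}
    (h1 : AnalyticOnNhd ℝ H S) (hB : IsBoundedBilinearMap ℝ B) (h2 : AnalyticOnNhd ℝ K S) :
    AnalyticOnNhd ℝ (fun p => B (H p, K p)) S := fun p hp =>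
  (hB.toContinuousLinearMap.analyticAt_bilinear (_, _)).comp_of_eq
    ((h1 p hp).prod (h2 p hp)) rfl

section rules
variable {H K : ℝ × ℝ → V} {p : ℝ × ℝ}

theorem dXi_congr (h : H =ᶠ[nhds p] K) : dXi H p = dXi K p := by
  simp only [dXi, h.fderiv_eq]

theorem dEta_congr (h : H =ᶠ[nhds p] K) : dEta H p = dEta K p := by
  simp only [dEta, h.fderiv_eq]

theorem dXi_add (hH : DifferentiableAt ℝ H p) (hK : DifferentiableAt ℝ K p) :
    dXi (fun x => H x + K x) p = dXi H p + dXi K p := by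
  simp only [dXi, fderiv_fun_add hH hK, add_apply]

theorem dEta_add (hH : DifferentiableAt ℝ H p) (hK : DifferentiableAt ℝ K p) :
    dEta (fun x => H x + K x) p = dEta H p + dEta K p := by
  simp only [dEta, fderiv_fun_add hH hK, add_apply]

theorem dXi_sub (hH : DifferentiableAt ℝ H p) (hK : DifferentiableAt ℝ K p) :
    dXi (fun x => H x - K x) p = dXi H p - dXi K p := by
  simp only [dXi, fderiv_fun_sub hH hK, sub_apply]

theorem dEta_sub (hH : DifferentiableAt ℝ H p) (hK : DifferentiableAt ℝ K p) :
    dEta (fun x => H x - K x) p = dEta H p - dEta K p := by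
  simp only [dEta, fderiv_fun_sub hH hK, sub_apply]

theorem dXi_neg : dXi (fun x => -H x) p = -dXi H p := by
  simp only [dXi, fderiv_fun_neg, neg_apply]

theorem dEta_neg : dEta (fun x => -H x) p = -dEta H p := by
  simp only [dEta, fderiv_fun_neg, neg_apply]

theorem dXi_const (c : V) : dXi (fun _ => c) p = 0 := by simp [dXi]

theorem dEta_const (c : V) : dEta (fun _ => c) p = 0 := by simp [dEta]

theorem dXi_bilin {B : V × W → X} (hB : IsBoundedBilinearMap ℝ B) {K : ℝ × ℝ → W}
    (hH : DifferentiableAt ℝ H p) (hK : DifferentiableAt ℝ K p) :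
    dXi (fun x => B (H x, K x)) p = B (H p, dXi K p) + B (dXi H p, K p) := by
  have := ((hB.hasFDerivAt (H p, K p)).comp p (hH.hasFDerivAt.prodMk hK.hasFDerivAt)).fderiv
  simp only [dXi]
  erw [this]
  rfl

theorem dEta_bilin {B : V × W → X} (hB : IsBoundedBilinearMap ℝ B) {K : ℝ × ℝ → W}
    (hH : DifferentiableAt ℝ H p) (hK : DifferentiableAt ℝ K p) :
    dEta (fun x => B (H x, K x)) p = B (H p, dEta K p) + B (dEta H p, K p) := by
  have := ((hB.hasFDerivAt (H p, K p)).comp p (hH.hasFDerivAt.prodMk hK.hasFDerivAt)).fderiv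
  simp only [dEta]
  erw [this]
  rfl

theorem dXi_clm (L : V →L[ℝ] W) (hH : DifferentiableAt ℝ H p) :
    dXi (fun x => L (H x)) p = L (dXi H p) := by
  have := (L.hasFDerivAt.comp p hH.hasFDerivAt).fderiv
  simp only [dXi]
  erw [this]
  rfl

theorem dEta_clm (L : V →L[ℝ] W) (hH : DifferentiableAt ℝ H p) :
    dEta (fun x => L (H x)) p = L (dEta H p) := by
  have := (L.hasFDerivAt.comp p hH.hasFDerivAt).fderiv
  simp only [dEta]
  erw [this]
  rfl

theorem dEta_dXi [CompleteSpace V] (hH : AnalyticAt ℝ H p) : dEta (dXi H) p = dXi (dEta H) p := by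
  have hd : DifferentiableAt ℝ (fderiv ℝ H) p := by
    have h2 : ContDiffAt ℝ 2 H p := hH.contDiffAt
    exact (h2.fderiv_right (m := 1) (by norm_num)).differentiableAt (by norm_num)
  have hs : IsSymmSndFDerivAt ℝ H p :=
    ContDiffAt.isSymmSndFDerivAt (n := 2) hH.contDiffAt (by simp)
  have h1 : dEta (dXi H) p = fderiv ℝ (fderiv ℝ H) p (0, 1) (1, 0) := by
    have := dEta_clm (ContinuousLinearMap.apply ℝ V ((1, 0) : ℝ × ℝ)) hd
    exact this
  have h2 : dXi (dEta H) p = fderiv ℝ (fderiv ℝ H) p (1, 0) (0, 1) := by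
    have := dXi_clm (ContinuousLinearMap.apply ℝ V ((0, 1) : ℝ × ℝ)) hd
    exact this
  rw [h1, h2, hs.eq]

theorem hasDerivAt_xi (hH : DifferentiableAt ℝ H p) :
    HasDerivAt (fun s => H (s, p.2)) (dXi H p) p.1 := by
  have h : HasFDerivAt H (fderiv ℝ H p) (p.1, p.2) := hH.hasFDerivAt
  exact h.comp_hasDerivAt p.1 ((hasDerivAt_id p.1).prodMk (hasDerivAt_const p.1 p.2))

theorem hasDerivAt_eta (hH : DifferentiableAt ℝ H p) :
    HasDerivAt (fun s => H (p.1, s)) (dEta H p) p.2 := by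
  have h : HasFDerivAt H (fderiv ℝ H p) (p.1, p.2) := hH.hasFDerivAt
  exact h.comp_hasDerivAt p.2 ((hasDerivAt_const p.2 p.1).prodMk (hasDerivAt_id p.2))

end rules

/-- `Flat S k H` says that on the part of the axis `η = 0` in the open set `S` the function `H`
and its first `k - 1` derivatives in the direction of `η` vanish. -/
def Flat (S : Set (ℝ × ℝ)) : ℕ → (ℝ × ℝ → V) → Prop
  | 0, _ => True
  | k + 1, H => (∀ ξ, (ξ, 0) ∈ S → H (ξ, 0) = 0) ∧ Flat S k (dEta H)

namespace Flat
variable {S : Set (ℝ × ℝ)} {k : ℕ}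

theorem congr (hS : IsOpen S) : ∀ {k : ℕ} {H K : ℝ × ℝ → V}, Flat S k H → Set.EqOn H K S →
    Flat S k K
  | 0, _, _, _, _ => trivial
  | k + 1, H, K, h, e => by
    refine ⟨fun ξ hξ => by rw [← e hξ, h.1 ξ hξ], congr hS h.2 fun p hp => dEta_congr ?_⟩
    filter_upwards [hS.mem_nhds hp] with q hq using e hq

theorem zero : ∀ k : ℕ, Flat S k (fun _ => (0 : V))
  | 0 => trivial
  | k + 1 => ⟨fun _ _ => rfl, by
      have : dEta (fun _ : ℝ × ℝ => (0 : V)) = fun _ => 0 := funext fun p => dEta_const 0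
      rw [this]; exact zero k⟩

theorem pred : ∀ {k : ℕ} {H : ℝ × ℝ → V}, Flat S (k + 1) H → Flat S k H
  | 0, _, _ => trivial
  | _ + 1, _, h => ⟨h.1, pred h.2⟩

theorem add [CompleteSpace V] (hS : IsOpen S) : ∀ {k : ℕ} {H K : ℝ × ℝ → V},
    AnalyticOnNhd ℝ H S → AnalyticOnNhd ℝ K S → Flat S k H → Flat S k K →
    Flat S k (fun p => H p + K p)
  | 0, _, _, _, _, _, _ => trivial
  | k + 1, H, K, aH, aK, hH, hK => by
    refine ⟨fun ξ hξ => by beta_reduce; rw [hH.1 ξ hξ, hK.1 ξ hξ, add_zero], ?_⟩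
    exact congr hS (add hS aH.dEta aK.dEta hH.2 hK.2) fun p hp =>
      (dEta_add (aH p hp).differentiableAt (aK p hp).differentiableAt).symm

theorem neg (hS : IsOpen S) : ∀ {k : ℕ} {H : ℝ × ℝ → V}, Flat S k H →
    Flat S k (fun p => -H p)
  | 0, _, _ => trivial
  | k + 1, H, hH => by
    refine ⟨fun ξ hξ => by beta_reduce; rw [hH.1 ξ hξ, neg_zero], ?_⟩
    exact congr hS (neg hS hH.2) fun p hp => dEta_neg.symm

theorem sub [CompleteSpace V] (hS : IsOpen S) {k : ℕ} {H K : ℝ × ℝ → V}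
    (aH : AnalyticOnNhd ℝ H S) (aK : AnalyticOnNhd ℝ K S) (hH : Flat S k H) (hK : Flat S k K) :
    Flat S k (fun p => H p - K p) := by
  simp only [sub_eq_add_neg]
  exact add hS aH aK.neg hH (neg hS hK)

theorem bilin_left [CompleteSpace V] [CompleteSpace W] [CompleteSpace X] (hS : IsOpen S)
    {B : V × W → X} (hB : IsBoundedBilinearMap ℝ B) : ∀ {k : ℕ} {H : ℝ × ℝ → V} {K : ℝ × ℝ → W},
    AnalyticOnNhd ℝ H S → AnalyticOnNhd ℝ K S → Flat S k H → Flat S k (fun p => B (H p, K p))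
  | 0, _, _, _, _, _ => trivial
  | k + 1, H, K, aH, aK, hH => by
    refine ⟨fun ξ hξ => by beta_reduce; rw [hH.1 ξ hξ]; simpa using hB.smul_left 0 0 (K (ξ, 0)), ?_⟩
    refine congr hS (add hS (aH.bilin hB aK.dEta) (aH.dEta.bilin hB aK)
      (bilin_left hS hB aH aK.dEta hH.pred) (bilin_left hS hB aH.dEta aK hH.2)) fun p hp => ?_
    exact (dEta_bilin hB (aH p hp).differentiableAt (aK p hp).differentiableAt).symm

theorem bilin_right [CompleteSpace V] [CompleteSpace W] [CompleteSpace X] (hS : IsOpen S)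
    {B : V × W → X} (hB : IsBoundedBilinearMap ℝ B) {k : ℕ} {H : ℝ × ℝ → V} {K : ℝ × ℝ → W}
    (aH : AnalyticOnNhd ℝ H S) (aK : AnalyticOnNhd ℝ K S) (hK : Flat S k K) :
    Flat S k (fun p => B (H p, K p)) := by
  have hB' : IsBoundedBilinearMap ℝ (fun x : W × V => B (x.2, x.1)) := hB.symm
  exact bilin_left hS hB' aK aH hK

theorem dXi [CompleteSpace V] (hS : IsOpen S) : ∀ {k : ℕ} {H : ℝ × ℝ → V},
    AnalyticOnNhd ℝ H S → Flat S k H → Flat S k (dXi H)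
  | 0, _, _, _ => trivial
  | k + 1, H, aH, hH => by
    refine ⟨fun ξ hξ => ?_, congr hS (dXi hS aH.dEta hH.2) fun p hp => (dEta_dXi (aH p hp)).symm⟩
    have h1 := hasDerivAt_xi (aH _ hξ).differentiableAt
    have h2 : (fun s : ℝ => H (s, 0)) =ᶠ[nhds ξ] fun _ => 0 := by
      have : Filter.Tendsto (fun s : ℝ => (s, (0 : ℝ))) (nhds ξ) (nhds (ξ, 0)) :=
        (Continuous.prodMk_left (0 : ℝ)).tendsto ξ
      filter_upwards [this (hS.mem_nhds hξ)] with s hs using hH.1 s hs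
    exact h1.unique ((hasDerivAt_const ξ (0 : V)).congr_of_eventuallyEq h2)

theorem iteratedDeriv_eq_zero [CompleteSpace V] (hS : IsOpen S) {ξ : ℝ} (hξ : (ξ, 0) ∈ S) :
    ∀ {n : ℕ} {H : ℝ × ℝ → V}, AnalyticOnNhd ℝ H S → Flat S (n + 1) H →
    iteratedDeriv n (fun η => H (ξ, η)) 0 = 0
  | 0, _, _, h => by simpa using h.1 ξ hξ
  | n + 1, H, aH, h => by
    rw [iteratedDeriv_succ', ← iteratedDeriv_eq_zero hS hξ aH.dEta h.2]
    refine Filter.EventuallyEq.iteratedDeriv_eq n ?_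
    have : Filter.Tendsto (fun s : ℝ => (ξ, s)) (nhds 0) (nhds (ξ, 0)) :=
      (Continuous.prodMk_right ξ).tendsto 0
    filter_upwards [this (hS.mem_nhds hξ)] with s hs
    exact (hasDerivAt_eta (p := (ξ, s)) (aH _ hs).differentiableAt).deriv

/-- An analytic function on a box all of whose `η`-derivatives vanish on the axis `η = 0`
vanishes. -/
theorem eqOn_zero [CompleteSpace V] {a b : ℝ} {H : ℝ × ℝ → V} (aH : AnalyticOnNhd ℝ H (Box a b))
    (hH : ∀ k, Flat (Box a b) k H) : ∀ p ∈ Box a b, H p = 0 := by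
  rintro ⟨ξ, η⟩ ⟨hξ, hη⟩
  have hb : 0 < b := by have := hη.1.trans hη.2; linarith
  have h0 : (ξ, (0 : ℝ)) ∈ Box a b := ⟨hξ, by constructor <;> simp [hb]⟩
  have an : AnalyticOnNhd ℝ (fun s => H (ξ, s)) (Set.Ioo (-b) b) := fun s hs =>
    (aH (ξ, s) ⟨hξ, hs⟩).comp (analyticAt_const.prod analyticAt_id)
  have z : (fun s => H (ξ, s)) =ᶠ[nhds 0] 0 := by
    obtain ⟨q, R, hq⟩ := an 0 h0.2
    have : ∀ᶠ s in nhds (0 : ℝ), s ∈ Metric.eball (0 : ℝ) R := Metric.eball_mem_nhds _ hq.r_pos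
    filter_upwards [this] with s hs
    have := hq.hasSum_iteratedFDeriv hs
    have e : ∀ n : ℕ, ((n.factorial : ℝ)⁻¹ •
        iteratedFDeriv ℝ n (fun s => H (ξ, s)) 0 fun _ => s) = 0 := fun n => by
      rw [iteratedFDeriv_apply_eq_iteratedDeriv_mul_prod,
        iteratedDeriv_eq_zero (isOpen_Box a b) h0 aH (hH _)]
      simp
    simp only [e, zero_add] at this
    exact this.unique hasSum_zero
  exact an.eqOn_zero_of_preconnected_of_eventuallyEq_zero isPreconnected_Ioo h0.2 z hη

end Flat

end PartialDerivatives

/-! ### Power series and joint analyticity -/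

section PowerSeries
variable {V : Type*} [NormedAddCommGroup V] [NormedSpace ℝ V]

theorem summable_norm_pow_smul {c : ℕ → V} {M R x : ℝ} (hc : ∀ n, ‖c n‖ ≤ M * R ^ n)
    (hx : |x| * R < 1) (hR : 0 ≤ R) : Summable fun n => ‖x ^ n • c n‖ := by
  refine Summable.of_nonneg_of_le (fun _ => norm_nonneg _) (fun n => ?_)
    ((summable_geometric_of_lt_one (by positivity) hx).mul_left M)
  rw [norm_smul, norm_pow, Real.norm_eq_abs, mul_pow]
  nlinarith [hc n, pow_nonneg (abs_nonneg x) n]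

variable [CompleteSpace V]

theorem summable_pow_smul {c : ℕ → V} {M R x : ℝ} (hc : ∀ n, ‖c n‖ ≤ M * R ^ n)
    (hx : |x| * R < 1) (hR : 0 ≤ R) : Summable fun n => x ^ n • c n :=
  (summable_norm_pow_smul hc hx hR).of_norm

theorem hasDerivAt_tsum_pow_smul {c : ℕ → V} {M R x : ℝ} (hR : 0 ≤ R)
    (hc : ∀ n, ‖c n‖ ≤ M * R ^ n) (hx : |x| * R < 1) :
    HasDerivAt (fun y : ℝ => ∑' n, y ^ n • c n) (∑' n : ℕ, ((n + 1) * x ^ n) • c (n + 1)) x := by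
  obtain ⟨q, hxq, hq⟩ : ∃ q, |x| < q ∧ q * R < 1 := by
    rcases hR.eq_or_lt with rfl | hR
    · exact ⟨|x| + 1, by linarith, by simp⟩
    · obtain ⟨q, h1, h2⟩ := exists_between ((lt_div_iff₀ hR).2 hx)
      exact ⟨q, h1, (lt_div_iff₀ hR).1 h2⟩
  have hq0 : 0 < q := (abs_nonneg x).trans_lt hxq
  have sg : Summable fun n : ℕ => n * q ^ (n - 1) * (M * R ^ n) := by
    rw [← summable_nat_add_iff 1]
    have h1 := summable_pow_mul_geometric_of_norm_lt_one 1 (r := q * R)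
      (by rwa [Real.norm_of_nonneg (by positivity)])
    have h0 := summable_geometric_of_lt_one (r := q * R) (by positivity) hq
    refine ((h1.add h0).mul_left (M * R)).congr fun n => ?_
    simp only [Nat.add_sub_cancel, mul_pow]
    push_cast
    ring
  have key := hasDerivAt_tsum_of_isPreconnected (t := Set.Ioo (-q) q) (y₀ := x) (y := x)
    (g := fun (n : ℕ) (y : ℝ) => y ^ n • c n)
    (g' := fun (n : ℕ) (y : ℝ) => (n * y ^ (n - 1)) • c n) sg
    isOpen_Ioo isPreconnected_Ioo (fun n y hy => (hasDerivAt_pow n y).smul_const _)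
    (fun n y hy => ?_) (abs_lt.1 hxq) (summable_pow_smul hc hx hR) (abs_lt.1 hxq)
  · convert key using 1
    have shift : Function.support (fun n : ℕ => ((n : ℝ) * x ^ (n - 1)) • c n) ⊆
        Set.range Nat.succ := by
      intro n hn
      cases n with
      | zero => simp at hn
      | succ n => exact ⟨n, rfl⟩
    rw [← Nat.succ_injective.tsum_eq shift]
    simp
  · have hy' : |y| ≤ q := (abs_lt.2 hy).le
    rw [norm_smul, norm_mul, norm_pow, Real.norm_eq_abs, Real.norm_eq_abs, Nat.abs_cast]
    gcongr
    exact hc n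

theorem analyticAt_tsum_pow_smul {c : ℕ → V} {M R x : ℝ} (hR : 0 < R)
    (hc : ∀ n, ‖c n‖ ≤ M * R ^ n) (hx : |x| * R < 1) :
    AnalyticAt ℝ (fun x : ℝ => ∑' n, x ^ n • c n) x := by
  let p : FormalMultilinearSeries ℝ ℝ V := fun n => ContinuousMultilinearMap.mkPiRing ℝ (Fin n) (c n)
  have hr : ENNReal.ofReal R⁻¹ ≤ p.radius := by
    refine p.le_radius_of_bound M (r := (R⁻¹).toNNReal) fun n => ?_
    rw [Real.coe_toNNReal _ (by positivity)]
    have : ‖p n‖ = ‖c n‖ := ContinuousMultilinearMap.norm_mkPiRing _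
    rw [this, inv_pow, ← div_eq_mul_inv, div_le_iff₀ (by positivity)]
    exact hc n
  have hpos : 0 < p.radius := lt_of_lt_of_le (by simpa using hR) hr
  have hs : p.sum = fun x : ℝ => ∑' n, x ^ n • c n := by
    funext x
    simp [FormalMultilinearSeries.sum, p]
  have := (p.hasFPowerSeriesOnBall hpos).analyticAt_of_mem (y := x) (by
    rw [Metric.mem_eball, edist_dist, dist_zero_right, Real.norm_eq_abs]
    refine lt_of_lt_of_le ?_ hr
    rw [ENNReal.ofReal_lt_ofReal_iff (by positivity), ← one_div, lt_div_iff₀ hR]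
    exact hx)
  rwa [hs] at this

open BoundedContinuousFunction in
/-- A power series in `η` whose coefficients are power series in `ξ`, with geometric bounds
on the coefficients, is jointly analytic. The sequence of the coefficients, suitably scaled, is an
analytic function of `ξ` with values in `ℓ^∞`, and the summation against `η ^ k` is an analytic
function of `η` with values in the continuous linear maps on `ℓ^∞`. -/
theorem analyticAt_double_series {u : ℕ → ℝ → V} {c : ℕ → ℕ → V} {ξ₀ η₀ M S T δ : ℝ}
    (hS : 0 < S) (hT : 0 < T) (hδ : 0 < δ) (hM : 0 ≤ M)
    (hc : ∀ k m, ‖c k m‖ ≤ M * S ^ m * T ^ k)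
    (hu : ∀ k x, |x| < δ → HasSum (fun m => x ^ m • c k m) (u k (ξ₀ + x)))
    (hη : |η₀| * T < 1) :
    AnalyticAt ℝ (fun p : ℝ × ℝ => ∑' k, p.2 ^ k • u k p.1) (ξ₀, η₀) := by
  have hC : ∀ m k, ‖(T ^ k)⁻¹ • c k m‖ ≤ M * S ^ m := fun m k => by
    rw [norm_smul, norm_inv, norm_pow, Real.norm_of_nonneg hT.le, inv_mul_le_iff₀ (by positivity)]
    linarith [hc k m]
  let C : ℕ → (ℕ →ᵇ V) := fun m =>
    ofNormedAddCommGroupDiscrete (fun k => (T ^ k)⁻¹ • c k m) (M * S ^ m) (hC m)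
  have hCn : ∀ m, ‖C m‖ ≤ M * S ^ m := fun m =>
    (norm_le (by positivity)).2 (hC m)
  let G : ℝ → (ℕ →ᵇ V) := fun x => ∑' m, x ^ m • C m
  have hG : AnalyticAt ℝ G 0 := analyticAt_tsum_pow_smul hS hCn (by simp)
  let ev : ℕ → ((ℕ →ᵇ V) →L[ℝ] V) := fun k => T ^ k • evalCLM ℝ k
  have hev : ∀ k, ‖ev k‖ ≤ 1 * T ^ k := fun k => by
    refine ContinuousLinearMap.opNorm_le_bound _ (by positivity) fun g => ?_
    have : ‖ev k g‖ = T ^ k * ‖g k‖ := by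
      simp [ev, norm_smul, abs_of_pos hT]
    rw [this, one_mul]
    gcongr
    exact g.norm_coe_le_norm k
  let L : ℝ → ((ℕ →ᵇ V) →L[ℝ] V) := fun t => ∑' k, t ^ k • ev k
  have hL : AnalyticAt ℝ L η₀ := analyticAt_tsum_pow_smul hT hev hη
  have key : AnalyticAt ℝ (fun p : ℝ × ℝ => L p.2 (G (p.1 - ξ₀))) (ξ₀, η₀) := by
    have h1 : AnalyticAt ℝ (fun p : ℝ × ℝ => L p.2) (ξ₀, η₀) :=
      hL.comp_of_eq analyticAt_snd rfl
    have h2 : AnalyticAt ℝ (fun p : ℝ × ℝ => G (p.1 - ξ₀)) (ξ₀, η₀) :=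
      hG.comp_of_eq (analyticAt_fst.sub analyticAt_const) (by simp)
    exact ((ContinuousLinearMap.id ℝ ((ℕ →ᵇ V) →L[ℝ] V)).analyticAt_bilinear (_, _)).comp_of_eq
      (h1.prod h2) rfl
  refine key.congr ?_
  have e1 : ∀ᶠ p : ℝ × ℝ in nhds (ξ₀, η₀), |p.1 - ξ₀| < δ :=
    (by fun_prop : Continuous fun p : ℝ × ℝ => |p.1 - ξ₀|).continuousAt.eventually_lt_const (by simpa)
  have e2 : ∀ᶠ p : ℝ × ℝ in nhds (ξ₀, η₀), |p.1 - ξ₀| * S < 1 :=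
    (by fun_prop : Continuous fun p : ℝ × ℝ => |p.1 - ξ₀| * S).continuousAt.eventually_lt_const
      (by simp)
  have e3 : ∀ᶠ p : ℝ × ℝ in nhds (ξ₀, η₀), |p.2| * T < 1 :=
    (by fun_prop : Continuous fun p : ℝ × ℝ => |p.2| * T).continuousAt.eventually_lt_const hη
  filter_upwards [e1, e2, e3] with p h1 h2 h3
  have hGk : ∀ k, G (p.1 - ξ₀) k = (T ^ k)⁻¹ • u k p.1 := fun k => by
    have s1 := (summable_pow_smul hCn h2 hS.le).hasSum.mapL (evalCLM ℝ k)
    have s2 := (hu k (p.1 - ξ₀) h1).const_smul ((T ^ k)⁻¹)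
    rw [add_sub_cancel] at s2
    refine s1.unique ?_
    convert s2 using 2 with m
    exact smul_comm _ _ _
  have s3 := (summable_pow_smul hev h3 hT.le).hasSum.mapL
    (ContinuousLinearMap.apply ℝ V (G (p.1 - ξ₀)))
  refine s3.tsum_eq.symm.trans (tsum_congr fun k => ?_)
  have : ev k (G (p.1 - ξ₀)) = u k p.1 := by
    simp only [ev, _root_.smul_apply, evalCLM_apply, hGk]
    rw [smul_inv_smul₀ (by positivity)]
  simp [this]

open scoped NNReal ENNReal in
/-- The derivatives of an analytic function satisfy uniform geometric bounds on compact sets. -/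
theorem IsCompact.exists_iteratedDeriv_bound {f : ℝ → V} {K : Set ℝ} (hK : IsCompact K)
    (hf : AnalyticOnNhd ℝ f K) :
    ∃ M > 0, ∃ R > 0, ∀ x ∈ K, ∀ n : ℕ, ‖iteratedDeriv n f x‖ ≤ n.factorial * (M * R ^ n) := by
  refine hK.induction_on (p := fun K => ∃ M > 0, ∃ R > 0, ∀ x ∈ K, ∀ n : ℕ,
    ‖iteratedDeriv n f x‖ ≤ n.factorial * (M * R ^ n)) ⟨1, one_pos, 1, one_pos, by simp⟩ ?_ ?_ ?_
  · rintro s t hst ⟨M, hM, R, hR, h⟩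
    exact ⟨M, hM, R, hR, fun x hx => h x (hst hx)⟩
  · rintro s t ⟨M, hM, R, hR, h⟩ ⟨M', hM', R', hR', h'⟩
    refine ⟨max M M', by positivity, max R R', by positivity, ?_⟩
    rintro x (hx | hx) n
    · refine (h x hx n).trans ?_
      gcongr <;> exact le_max_left _ _
    · refine (h' x hx n).trans ?_
      gcongr <;> exact le_max_right _ _
  · intro x hx
    obtain ⟨p, R, hp⟩ := hf x hx
    obtain ⟨ε, hε0, hε⟩ : ∃ ε : ℝ≥0, 0 < ε ∧ ((ε + ε : ℝ≥0) : ℝ≥0∞) < R := by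
      obtain ⟨q, hq0, hq⟩ := ENNReal.lt_iff_exists_nnreal_btwn.1 hp.r_pos
      exact ⟨q / 2, by simpa using hq0, by rwa [add_halves]⟩
    have hrad : ((ε : ℝ≥0∞) + ε) < p.radius := by
      have := hε.trans_le hp.r_le
      simpa using this
    have hsum := p.changeOriginSeries_summable_aux₁ hrad
    have hsum' := NNReal.summable_sigma.1 hsum
    set B : ℝ≥0 := ∑' k, ∑' s : Σ l : ℕ, { s : Finset (Fin (k + l)) // s.card = l },
      ‖p (k + s.1)‖₊ * ε ^ s.1 * ε ^ k with hB
    refine ⟨Metric.ball x ε, mem_nhdsWithin_of_mem_nhds (Metric.ball_mem_nhds x (by simpa)),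
      B + 1, by positivity, (ε : ℝ)⁻¹, by positivity, fun y hy n => ?_⟩
    have hy' : ‖y - x‖₊ < ε := by
      rw [Metric.mem_ball, dist_eq_norm] at hy
      exact_mod_cast hy
    have hyR : ((‖y - x‖₊ : ℝ≥0) : ℝ≥0∞) < R :=
      lt_of_le_of_lt (by exact_mod_cast hy'.le.trans (le_add_of_nonneg_right hε0.le)) hε
    have hq := hp.changeOrigin hyR
    rw [add_sub_cancel] at hq
    have h1 : iteratedDeriv n f y = n.factorial • p.changeOrigin (y - x) n (fun _ => 1) := by
      rw [hq.factorial_smul, iteratedDeriv_eq_iteratedFDeriv]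
    have h2 : ‖p.changeOrigin (y - x) n‖₊ * ε ^ n ≤ B := by
      calc _ ≤ (∑' s : Σ l : ℕ, { s : Finset (Fin (n + l)) // s.card = l },
            ‖p (n + s.1)‖₊ * ‖y - x‖₊ ^ s.1) * ε ^ n := by
            gcongr
            exact p.nnnorm_changeOrigin_le n (hyR.trans_le hp.r_le)
        _ ≤ ∑' s : Σ l : ℕ, { s : Finset (Fin (n + l)) // s.card = l },
            ‖p (n + s.1)‖₊ * ε ^ s.1 * ε ^ n := by
            rw [← NNReal.tsum_mul_right]
            refine Summable.tsum_le_tsum (fun s => ?_) ?_ (hsum'.1 n)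
            · gcongr
            · refine NNReal.summable_of_le (fun s => ?_) (hsum'.1 n)
              gcongr
        _ ≤ B := hsum'.2.le_tsum n fun _ _ => by positivity
    have h3 : ‖p.changeOrigin (y - x) n‖ * (ε : ℝ) ^ n ≤ B := by exact_mod_cast h2
    rw [h1, ← Nat.cast_smul_eq_nsmul ℝ, norm_smul, inv_pow]
    simp only [Real.norm_natCast]
    gcongr
    refine (ContinuousMultilinearMap.le_opNorm _ _).trans ?_
    simp only [norm_one, Finset.prod_const_one, mul_one]
    rw [← div_eq_mul_inv, le_div_iff₀ (by positivity)]
    linarith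

end PowerSeries

/-! ### The Cauchy–Kovalevskaya theorem for semilinear quadratic systems -/

section CauchyKovalevskaya
open Finset

theorem sum_antidiagonal_choose_mul_choose (a b k : ℕ) :
    ∑ ij ∈ antidiagonal k, (a + ij.1).choose a * (b + ij.2).choose b =
      (a + b + 1 + k).choose (a + b + 1) := by
  have h := pow_add (PowerSeries.mk 1 : PowerSeries ℤ) (a + 1) (b + 1)
  rw [show a + 1 + (b + 1) = (a + b + 1) + 1 by ring, PowerSeries.mk_one_pow_eq_mk_choose_add,
    PowerSeries.mk_one_pow_eq_mk_choose_add, PowerSeries.mk_one_pow_eq_mk_choose_add] at h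
  have := congrArg (PowerSeries.coeff k) h
  simp only [PowerSeries.coeff_mul, PowerSeries.coeff_mk] at this
  exact_mod_cast this.symm

/-- The Cauchy product of two absolutely convergent series with respect to a bilinear map. -/
theorem hasSum_bilin_antidiagonal {V W X : Type*} [NormedAddCommGroup V] [NormedSpace ℝ V]
    [NormedAddCommGroup W] [NormedSpace ℝ W] [NormedAddCommGroup X] [NormedSpace ℝ X]
    [CompleteSpace V] [CompleteSpace W] [CompleteSpace X] (Q : V →L[ℝ] W →L[ℝ] X)
    {f : ℕ → V} {g : ℕ → W} (hf : Summable fun n => ‖f n‖) (hg : Summable fun n => ‖g n‖) :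
    HasSum (fun n => ∑ ij ∈ antidiagonal n, Q (f ij.1) (g ij.2)) (Q (∑' n, f n) (∑' n, g n)) := by
  have hs : Summable fun x : ℕ × ℕ => Q (f x.1) (g x.2) := by
    refine Summable.of_norm_bounded (g := fun x : ℕ × ℕ => ‖Q‖ * (‖f x.1‖ * ‖g x.2‖))
      ((hf.mul_of_nonneg hg (fun _ => norm_nonneg _) (fun _ => norm_nonneg _)).mul_left _)
      fun x => ?_
    rw [← mul_assoc]
    exact Q.le_opNorm₂ _ _
  have h1 : HasSum (fun i => Q (f i) (∑' n, g n)) (∑' x : ℕ × ℕ, Q (f x.1) (g x.2)) :=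
    hs.hasSum.prod_fiberwise fun i => hg.of_norm.hasSum.mapL (Q (f i))
  have h2 : HasSum (fun i => Q (f i) (∑' n, g n)) (Q (∑' n, f n) (∑' n, g n)) :=
    hf.of_norm.hasSum.mapL (Q.flip (∑' n, g n))
  have h3 := hs.hasSum
  rw [h1.unique h2, ← HasAntidiagonal.sigmaAntidiagonalEquivProd.hasSum_iff] at h3
  refine h3.sigma fun n => ?_
  have := Finset.hasSum (antidiagonal n) (fun ij : ℕ × ℕ => Q (f ij.1) (g ij.2))
  exact this

variable {V : Type*} [NormedAddCommGroup V] [NormedSpace ℝ V]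
variable (A : V →L[ℝ] V) (Q : V →L[ℝ] V →L[ℝ] V) (u₀ : ℝ → V)

/-- The coefficients `u_k(ξ)` of the formal solution `∑ η ^ k • u_k(ξ)` of
`∂_η u = A (∂_ξ u) + Q(u, u)` with `u(ξ, 0) = u₀(ξ)`. -/
def formalSol : ℕ → ℝ → V
  | 0 => u₀
  | k + 1 => fun ξ => ((k : ℝ) + 1)⁻¹ • (A (deriv (formalSol k) ξ) +
      ∑ i : Fin (k + 1), Q (formalSol i ξ) (formalSol (k - i) ξ))
termination_by k => k
decreasing_by all_goals omega

theorem formalSol_succ (k : ℕ) : formalSol A Q u₀ (k + 1) = fun ξ => ((k : ℝ) + 1)⁻¹ •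
    (A (deriv (formalSol A Q u₀ k) ξ) +
      ∑ ij ∈ antidiagonal k, Q (formalSol A Q u₀ ij.1 ξ) (formalSol A Q u₀ ij.2 ξ)) := by
  rw [formalSol]
  funext ξ
  rw [Nat.sum_antidiagonal_eq_sum_range_succ
    (fun i j => Q (formalSol A Q u₀ i ξ) (formalSol A Q u₀ j ξ)), ← Fin.sum_univ_eq_sum_range
    (fun i => Q (formalSol A Q u₀ i ξ) (formalSol A Q u₀ (k - i) ξ))]

variable [CompleteSpace V] {A Q u₀}

theorem analyticOnNhd_formalSol {O : Set ℝ} (hu : AnalyticOnNhd ℝ u₀ O) (k : ℕ) :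
    AnalyticOnNhd ℝ (formalSol A Q u₀ k) O := by
  induction k using Nat.strong_induction_on with
  | _ k ih =>
    cases k with
    | zero => rwa [formalSol]
    | succ k =>
      rw [formalSol_succ]
      intro ξ hξ
      refine AnalyticAt.fun_const_smul (AnalyticAt.fun_add ?_ ?_)
      · exact (A.analyticAt _).comp (ih k (by omega) ξ hξ).deriv
      · refine Finset.analyticAt_fun_sum _ fun ij hij => ?_
        have := mem_antidiagonal.1 hij
        exact (Q.analyticAt_bilinear (_, _)).comp_of_eq
          ((ih ij.1 (by omega) ξ hξ).prod (ih ij.2 (by omega) ξ hξ)) rfl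

theorem norm_iteratedDeriv_bilin_le {f g : ℝ → V} {x : ℝ} (hf : AnalyticAt ℝ f x)
    (hg : AnalyticAt ℝ g x) (m : ℕ) :
    ‖iteratedDeriv m (fun y => Q (f y) (g y)) x‖ ≤ ‖Q‖ * ∑ i ∈ range (m + 1),
      (m.choose i : ℝ) * ‖iteratedDeriv i f x‖ * ‖iteratedDeriv (m - i) g x‖ := by
  obtain ⟨O, hO, hOo, hx⟩ := eventually_nhds_iff.1
    (hf.eventually_analyticAt.and hg.eventually_analyticAt)
  have := Q.norm_iteratedFDerivWithin_le_of_bilinear (N := ω) (n := m)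
    (fun y hy => (hO y hy).1.contDiffAt.contDiffWithinAt)
    (fun y hy => (hO y hy).2.contDiffAt.contDiffWithinAt) hOo.uniqueDiffOn hx (by simp)
  simpa only [iteratedFDerivWithin_of_isOpen _ hOo hx, norm_iteratedFDeriv_eq_norm_iteratedDeriv]
    using this

/-- The majorant estimate. The bounds are the Taylor coefficients of
`M / (1 - R ξ - T η)`, and they are reproduced by the recursion since `Φ(s) = 1 / (1 - s)`
satisfies `Φ ^ 2 = Φ'`. -/
theorem norm_iteratedDeriv_formalSol_le {ξ M R T : ℝ} (hM : 0 ≤ M) (hR : 0 ≤ R) (hT : 0 ≤ T)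
    (hATQ : ‖A‖ * R + ‖Q‖ * M ≤ T) (hu : AnalyticAt ℝ u₀ ξ)
    (hb : ∀ m : ℕ, ‖iteratedDeriv m u₀ ξ‖ ≤ m.factorial * (M * R ^ m)) (k m : ℕ) :
    ‖iteratedDeriv m (formalSol A Q u₀ k) ξ‖ ≤
      m.factorial * (M * (m + k).choose m * R ^ m * T ^ k) := by
  have an : ∀ k, AnalyticAt ℝ (formalSol A Q u₀ k) ξ := fun k =>
    analyticOnNhd_formalSol (O := {ξ}) (by simpa [AnalyticOnNhd] using hu) k ξ rfl
  induction k using Nat.strong_induction_on generalizing m with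
  | _ k ih =>
    cases k with
    | zero => simpa [formalSol] using hb m
    | succ k =>
      set U := formalSol A Q u₀ with hU
      have a1 : AnalyticAt ℝ (fun ξ => A (deriv (U k) ξ)) ξ :=
        (A.analyticAt _).comp (an k).deriv
      have a2 : ∀ ij : ℕ × ℕ, AnalyticAt ℝ (fun ξ => Q (U ij.1 ξ) (U ij.2 ξ)) ξ := fun ij =>
        (Q.analyticAt_bilinear (_, _)).comp_of_eq ((an ij.1).prod (an ij.2)) rfl
      have e : iteratedDeriv m (U (k + 1)) ξ = ((k : ℝ) + 1)⁻¹ • (A (iteratedDeriv (m + 1) (U k) ξ) +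
          ∑ ij ∈ antidiagonal k, iteratedDeriv m (fun ξ => Q (U ij.1 ξ) (U ij.2 ξ)) ξ) := by
        rw [hU, formalSol_succ, ← hU, iteratedDeriv_fun_const_smul_field,
          iteratedDeriv_fun_add a1.contDiffAt
            (Finset.analyticAt_fun_sum _ fun ij _ => a2 ij).contDiffAt,
          iteratedDeriv_fun_sum fun ij _ => (a2 ij).contDiffAt, iteratedDeriv_succ']
        congr 2
        simp only [iteratedDeriv_eq_iteratedFDeriv]
        have := A.iteratedFDeriv_comp_left (i := m) (an k).deriv.contDiffAt le_rfl
        exact congrFun (congrArg DFunLike.coe this) _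
      set c : ℝ := (((m + 1 + k).choose (m + 1) : ℕ) : ℝ) with hc
      have b1 : ‖A (iteratedDeriv (m + 1) (U k) ξ)‖ ≤
          m.factorial * M * R ^ m * T ^ k * ((m + 1) * c) * (‖A‖ * R) := by
        refine (A.le_opNorm _).trans ?_
        refine (mul_le_mul_of_nonneg_left (ih k (by omega) (m + 1)) (norm_nonneg _)).trans_eq ?_
        rw [Nat.factorial_succ]
        push_cast
        ring
      have b2 : ∀ ij ∈ antidiagonal k, ‖iteratedDeriv m (fun ξ => Q (U ij.1 ξ) (U ij.2 ξ)) ξ‖ ≤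
          ‖Q‖ * ∑ a ∈ range (m + 1), m.factorial * M ^ 2 * R ^ m * T ^ k *
            ((a + ij.1).choose a * ((m - a) + ij.2).choose (m - a) : ℕ) := by
        intro ij hij
        have hij' := mem_antidiagonal.1 hij
        refine (norm_iteratedDeriv_bilin_le (an _) (an _) m).trans ?_
        refine mul_le_mul_of_nonneg_left (sum_le_sum fun a ha => ?_) (by positivity)
        have ham : a ≤ m := by simpa [Nat.lt_succ_iff] using ha
        calc (m.choose a : ℝ) * ‖iteratedDeriv a (U ij.1) ξ‖ * ‖iteratedDeriv (m - a) (U ij.2) ξ‖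
            ≤ (m.choose a : ℝ) * (a.factorial * (M * (a + ij.1).choose a * R ^ a * T ^ ij.1)) *
              ((m - a).factorial *
                (M * ((m - a) + ij.2).choose (m - a) * R ^ (m - a) * T ^ ij.2)) := by
              gcongr
              · exact ih _ (by omega) _
              · exact ih _ (by omega) _
          _ = _ := by
              have h1 : (m.factorial : ℝ) = m.choose a * a.factorial * (m - a).factorial := by
                exact_mod_cast (Nat.choose_mul_factorial_mul_factorial ham).symm
              have h2 : R ^ m = R ^ a * R ^ (m - a) := by rw [← pow_add, Nat.add_sub_cancel' ham]
              have h3 : T ^ k = T ^ ij.1 * T ^ ij.2 := by rw [← pow_add, hij']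
              rw [h1, h2, h3]
              push_cast
              ring
      have b3 : ‖∑ ij ∈ antidiagonal k, iteratedDeriv m (fun ξ => Q (U ij.1 ξ) (U ij.2 ξ)) ξ‖ ≤
          m.factorial * M * R ^ m * T ^ k * ((m + 1) * c) * (‖Q‖ * M) := by
        refine (norm_sum_le_of_le _ b2).trans_eq ?_
        rw [← mul_sum, sum_comm]
        have : ∀ a ∈ range (m + 1), ∑ ij ∈ antidiagonal k, (m.factorial : ℝ) * M ^ 2 * R ^ m * T ^ k *
            ((a + ij.1).choose a * ((m - a) + ij.2).choose (m - a) : ℕ) =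
            m.factorial * M ^ 2 * R ^ m * T ^ k * c := by
          intro a ha
          have ham : a ≤ m := by simpa [Nat.lt_succ_iff] using ha
          rw [← mul_sum, ← Nat.cast_sum, sum_antidiagonal_choose_mul_choose,
            Nat.add_sub_cancel' ham]
        rw [sum_congr rfl this, sum_const, card_range, nsmul_eq_mul]
        push_cast
        ring
      have hck : (m + 1) * c = (k + 1) * (((m + (k + 1)).choose m : ℕ) : ℝ) := by
        have := Nat.choose_succ_right_eq (m + 1 + k) m
        rw [show m + 1 + k - m = k + 1 by omega] at this
        rw [hc, show m + (k + 1) = m + 1 + k by ring]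
        have h' : (((m + 1 + k).choose (m + 1) * (m + 1) : ℕ) : ℝ) =
          ((m + 1 + k).choose m * (k + 1) : ℕ) := by rw [this]
        push_cast at h'
        linarith
      have hk : (0 : ℝ) < k + 1 := by positivity
      rw [e, norm_smul, norm_inv, Real.norm_of_nonneg hk.le, inv_mul_le_iff₀ hk]
      calc _ ≤ _ := (norm_add_le _ _).trans (add_le_add b1 b3)
        _ = m.factorial * M * R ^ m * T ^ k * ((m + 1) * c) * (‖A‖ * R + ‖Q‖ * M) := by ring
        _ ≤ m.factorial * M * R ^ m * T ^ k * ((m + 1) * c) * T := by gcongr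
        _ = _ := by rw [hck]; ring

/-- The Cauchy–Kovalevskaya theorem for semilinear systems `∂_η u = A (∂_ξ u) + Q(u, u)` with
constant coefficients and quadratic nonlinearity. The solution exists on a box whose side
in the direction of `ξ` is the whole interval on which the Cauchy data are given. -/
theorem exists_analytic_solution (A : V →L[ℝ] V) (Q : V →L[ℝ] V →L[ℝ] V) {u₀ : ℝ → V} {r : ℝ}
    (hu : AnalyticOnNhd ℝ u₀ (Set.Icc (-r) r)) :
    ∃ b > 0, ∃ u : ℝ × ℝ → V, AnalyticOnNhd ℝ u (Box r b) ∧
      (∀ ξ ∈ Set.Ioo (-r) r, u (ξ, 0) = u₀ ξ) ∧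
      ∀ p ∈ Box r b, dEta u p = A (dXi u p) + Q (u p) (u p) := by
  obtain ⟨M, hM, R, hR, hb⟩ := isCompact_Icc.exists_iteratedDeriv_bound hu
  set T : ℝ := ‖A‖ * R + ‖Q‖ * M + 1 with hT
  have hT0 : 0 < T := by positivity
  set U := formalSol A Q u₀ with hU
  have an : ∀ k, AnalyticOnNhd ℝ (U k) (Set.Icc (-r) r) := analyticOnNhd_formalSol hu
  -- `C(m + k, m) ≤ 2 ^ (m + k)`, so the Taylor coefficients are bounded geometrically.
  have bd : ∀ ξ ∈ Set.Icc (-r) r, ∀ k m : ℕ, ‖iteratedDeriv m (U k) ξ‖ ≤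
      m.factorial * (M * (2 * R) ^ m * (2 * T) ^ k) := by
    intro ξ hξ k m
    refine (norm_iteratedDeriv_formalSol_le hM.le hR.le hT0.le (by linarith) (hu ξ hξ)
      (hb ξ hξ) k m).trans ?_
    have h2 : ((m + k).choose m : ℝ) ≤ 2 ^ m * 2 ^ k := by
      rw [← pow_add]
      exact_mod_cast Nat.choose_le_two_pow _ _
    calc _ ≤ (m.factorial : ℝ) * (M * (2 ^ m * 2 ^ k) * R ^ m * T ^ k) := by gcongr
      _ = _ := by rw [mul_pow, mul_pow]; ring
  set b : ℝ := (2 * T)⁻¹ with hbdef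
  have hb0 : 0 < b := by positivity
  have lt_b : ∀ {η : ℝ}, |η| < b → |η| * (2 * T) < 1 := fun {η} h => by
    rwa [hbdef, ← one_div, lt_div_iff₀ (by positivity)] at h
  have bd0 : ∀ ξ ∈ Set.Icc (-r) r, ∀ k, ‖U k ξ‖ ≤ M * (2 * T) ^ k := fun ξ hξ k => by
    simpa using bd ξ hξ k 0
  have bd1 : ∀ ξ ∈ Set.Icc (-r) r, ∀ k, ‖deriv (U k) ξ‖ ≤ (M * (2 * R)) * (2 * T) ^ k :=
    fun ξ hξ k => by simpa using bd ξ hξ k 1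
  have cb : ∀ ξ ∈ Set.Icc (-r) r, ∀ k m : ℕ, ‖(m.factorial : ℝ)⁻¹ • iteratedDeriv m (U k) ξ‖ ≤
      M * (2 * R) ^ m * (2 * T) ^ k := fun ξ hξ k m => by
    rw [norm_smul, norm_inv, Real.norm_natCast, inv_mul_le_iff₀ (by positivity)]
    exact bd ξ hξ k m
  -- By the identity theorem the Taylor series represents `U k` on an interval independent of `k`.
  have taylor : ∀ ξ ∈ Set.Ioo (-r) r, ∃ δ > 0, ∀ k x, |x| < δ →
      HasSum (fun m => x ^ m • ((m.factorial : ℝ)⁻¹ • iteratedDeriv m (U k) ξ)) (U k (ξ + x)) := by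
    intro ξ hξ
    have hξ' := Set.Ioo_subset_Icc_self hξ
    obtain ⟨ε, hε, hball⟩ := Metric.isOpen_iff.1 isOpen_Ioo ξ hξ
    refine ⟨min ε (2 * R)⁻¹, by positivity, fun k x hx => ?_⟩
    have lt_R : ∀ {y : ℝ}, |y| < min ε (2 * R)⁻¹ → |y| * (2 * R) < 1 := fun {y} h => by
      have := h.trans_le (min_le_right _ _)
      rwa [← one_div, lt_div_iff₀ (by positivity)] at this
    have cb' : ∀ m : ℕ, ‖(m.factorial : ℝ)⁻¹ • iteratedDeriv m (U k) ξ‖ ≤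
        M * (2 * T) ^ k * (2 * R) ^ m := fun m => by linarith [cb ξ hξ' k m]
    have a1 : AnalyticOnNhd ℝ (fun x : ℝ => ∑' m : ℕ, x ^ m • ((m.factorial : ℝ)⁻¹ •
        iteratedDeriv m (U k) ξ)) (Metric.ball 0 (min ε (2 * R)⁻¹)) := fun y hy =>
      analyticAt_tsum_pow_smul (by positivity) cb' (lt_R (by simpa using hy))
    have a2 : AnalyticOnNhd ℝ (fun x : ℝ => U k (ξ + x)) (Metric.ball 0 (min ε (2 * R)⁻¹)) := by
      intro y hy
      have hy' : ξ + y ∈ Set.Ioo (-r) r := hball (by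
        have : |y| < min ε (2 * R)⁻¹ := by simpa using hy
        simpa [dist_eq_norm] using this.trans_le (min_le_left _ _))
      exact (an k _ (Set.Ioo_subset_Icc_self hy')).comp_of_eq
        (analyticAt_const.add analyticAt_id) rfl
    have e : (fun x : ℝ => ∑' m : ℕ, x ^ m • ((m.factorial : ℝ)⁻¹ •
        iteratedDeriv m (U k) ξ)) =ᶠ[nhds 0] fun x : ℝ => U k (ξ + x) := by
      obtain ⟨q, ρ, hq⟩ := an k ξ hξ'
      filter_upwards [Metric.eball_mem_nhds (0 : ℝ) hq.r_pos] with y hy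
      rw [← (hq.hasSum_iteratedFDeriv hy).tsum_eq]
      refine tsum_congr fun m => ?_
      rw [iteratedFDeriv_apply_eq_iteratedDeriv_mul_prod]
      simp only [prod_const, card_univ, Fintype.card_fin]
      exact smul_comm _ _ _
    have := a1.eqOn_of_preconnected_of_eventuallyEq a2 (convex_ball _ _).isPreconnected
      (Metric.mem_ball_self (by positivity)) e (x := x) (by simpa using hx)
    beta_reduce at this
    rw [← this]
    exact (summable_pow_smul cb' (lt_R hx) (by positivity)).hasSum
  set u : ℝ × ℝ → V := fun p => ∑' k, p.2 ^ k • U k p.1 with hudef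
  have hAn : AnalyticOnNhd ℝ u (Box r b) := by
    rintro ⟨ξ, η⟩ ⟨hξ, hη⟩
    have hξ' := Set.Ioo_subset_Icc_self hξ
    obtain ⟨δ, hδ, h⟩ := taylor ξ hξ
    exact analyticAt_double_series (S := 2 * R) (T := 2 * T) (by positivity) (by positivity) hδ
      hM.le (cb ξ hξ') h (lt_b (abs_lt.2 hη))
  refine ⟨b, hb0, u, hAn, fun ξ _ => ?_, ?_⟩
  · rw [hudef]
    beta_reduce
    rw [tsum_eq_single 0 fun k hk => by simp [hk]]
    simp [hU, formalSol]
  · rintro ⟨ξ, η⟩ ⟨hξ, hη⟩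
    have hξ' := Set.Ioo_subset_Icc_self hξ
    have hη' : |η| < b := abs_lt.2 hη
    have hdiff := (hAn (ξ, η) ⟨hξ, hη⟩).differentiableAt
    have T2 : (0 : ℝ) ≤ 2 * T := by positivity
    have hs0 : Summable fun k => η ^ k • U k ξ := summable_pow_smul (bd0 ξ hξ') (lt_b hη') T2
    have hsξ : Summable fun k => η ^ k • deriv (U k) ξ :=
      summable_pow_smul (bd1 ξ hξ') (lt_b hη') T2
    have hnorm : Summable fun k => ‖η ^ k • U k ξ‖ :=
      summable_norm_pow_smul (bd0 ξ hξ') (lt_b hη') T2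
    have dξ : dXi u (ξ, η) = ∑' k, η ^ k • deriv (U k) ξ := by
      have key := hasDerivAt_tsum_of_isPreconnected (t := Set.Ioo (-r) r)
        (u := fun k => M * (2 * R) * (|η| * (2 * T)) ^ k) (y₀ := ξ) (y := ξ)
        (g := fun (k : ℕ) (y : ℝ) => η ^ k • U k y)
        (g' := fun (k : ℕ) (y : ℝ) => η ^ k • deriv (U k) y)
        ((summable_geometric_of_lt_one (by positivity) (lt_b hη')).mul_left _)
        isOpen_Ioo isPreconnected_Ioo (fun k y hy => ?_) (fun k y hy => ?_) hξ hs0 hξ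
      · exact (hasDerivAt_xi hdiff).unique key
      · exact ((an k y (Set.Ioo_subset_Icc_self hy)).differentiableAt.hasDerivAt).const_smul _
      · rw [norm_smul, norm_pow, Real.norm_eq_abs, mul_pow]
        nlinarith [bd1 y (Set.Ioo_subset_Icc_self hy) k, pow_nonneg (abs_nonneg η) k]
    have dη : dEta u (ξ, η) = ∑' k : ℕ, ((k + 1) * η ^ k) • U (k + 1) ξ :=
      (hasDerivAt_eta hdiff).unique (hasDerivAt_tsum_pow_smul T2 (bd0 ξ hξ') (lt_b hη'))
    have hA : HasSum (fun k => η ^ k • A (deriv (U k) ξ)) (A (∑' k, η ^ k • deriv (U k) ξ)) := by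
      simpa using hsξ.hasSum.mapL A
    have hQ := hasSum_bilin_antidiagonal Q hnorm hnorm
    have hu_eq : u (ξ, η) = ∑' k, η ^ k • U k ξ := rfl
    rw [dη, dξ, hu_eq, ← (hA.add hQ).tsum_eq]
    refine tsum_congr fun k => ?_
    have hk : ((k : ℝ) + 1) ≠ 0 := by positivity
    rw [hU, formalSol_succ, ← hU, smul_smul]
    rw [mul_right_comm, mul_inv_cancel₀ hk, one_mul, smul_add, smul_sum]
    congr 1
    refine sum_congr rfl fun ij hij => ?_
    rw [← mem_antidiagonal.1 hij, pow_add]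
    simp only [map_smul, _root_.smul_apply, smul_smul]
    rw [mul_comm (η ^ ij.1)]

end CauchyKovalevskaya

/-! ### The cross product -/

section CrossProduct

theorem cross_apply_zero (a b : E3) : cross a b 0 = a 1 * b 2 - a 2 * b 1 := by
  simp [cross, crossProduct]

theorem cross_apply_one (a b : E3) : cross a b 1 = a 2 * b 0 - a 0 * b 2 := by
  simp [cross, crossProduct]

theorem cross_apply_two (a b : E3) : cross a b 2 = a 0 * b 1 - a 1 * b 0 := by
  simp [cross, crossProduct]

theorem inner_E3 (a b : E3) : inner ℝ a b = a 0 * b 0 + a 1 * b 1 + a 2 * b 2 := by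
  simp [PiLp.inner_apply, Fin.sum_univ_three, mul_comm]

theorem E3_ext {a b : E3} (h0 : a 0 = b 0) (h1 : a 1 = b 1) (h2 : a 2 = b 2) : a = b := by
  ext i
  fin_cases i
  exacts [h0, h1, h2]

theorem isBoundedBilinearMap_cross :
    IsBoundedBilinearMap ℝ (fun x : E3 × E3 => cross x.1 x.2) :=
  (LinearMap.mk₂ ℝ cross
    (fun a b c => by simp [cross]) (fun t a b => by simp [cross])
    (fun a b c => by simp [cross]) (fun t a b => by simp [cross])
    ).toContinuousBilinearMap.isBoundedBilinearMap

theorem inner_cross_self_left (a b : E3) : inner ℝ (cross a b) a = 0 := by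
  simp only [inner_E3, cross_apply_zero, cross_apply_one, cross_apply_two]
  ring

theorem inner_cross_self_right (a b : E3) : inner ℝ (cross a b) b = 0 := by
  simp only [inner_E3, cross_apply_zero, cross_apply_one, cross_apply_two]
  ring

theorem inner_cross_cross (a b : E3) : inner ℝ (cross a b) (cross a b) =
    inner ℝ a a * inner ℝ b b - inner ℝ a b ^ 2 := by
  simp only [inner_E3, cross_apply_zero, cross_apply_one, cross_apply_two]
  ring

theorem cross_cross_self (a b : E3) : cross (cross a b) a =
    (inner ℝ a a : ℝ) • b - (inner ℝ a b : ℝ) • a := by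
  apply E3_ext <;>
  · simp only [inner_E3, cross_apply_zero, cross_apply_one, cross_apply_two, PiLp.sub_apply,
      PiLp.smul_apply, smul_eq_mul]
    ring

/-- A vector orthogonal to `a` and `b` is a multiple of `a × b`. -/
theorem smul_eq_of_orthogonal {a b w : E3} (ha : inner ℝ w a = 0) (hb : inner ℝ w b = 0) :
    (inner ℝ (cross a b) (cross a b) : ℝ) • w = (inner ℝ w (cross a b) : ℝ) • cross a b := by
  have key : (inner ℝ (cross a b) (cross a b) : ℝ) • w = (inner ℝ w (cross a b) : ℝ) • cross a b +
      (inner ℝ w a : ℝ) • cross b (cross a b) + (inner ℝ w b : ℝ) • cross (cross a b) a := by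
    apply E3_ext <;>
    · simp only [inner_E3, cross_apply_zero, cross_apply_one, cross_apply_two, PiLp.add_apply,
        PiLp.smul_apply, smul_eq_mul]
      ring
  rw [key, ha, hb, zero_smul, zero_smul, add_zero, add_zero]

theorem cross_smul_smul (s t : ℝ) (a b : E3) : cross (s • a) (t • b) = (s * t) • cross a b := by
  simp [cross, smul_smul, mul_comm]

theorem cross_half_add_sub (a b : E3) :
    cross ((1 / 2 : ℝ) • (a + b)) ((1 / 2 : ℝ) • (b - a)) = (1 / 2 : ℝ) • cross a b := by
  apply E3_ext <;>
  · simp only [cross_apply_zero, cross_apply_one, cross_apply_two, PiLp.sub_apply, PiLp.add_apply,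
      PiLp.smul_apply, smul_eq_mul]
    ring

end CrossProduct

/-! ### First and second derivatives in the two coordinate systems -/

section Coordinates
variable {F : ℝ × ℝ → E3} {p : ℝ × ℝ}

theorem dX_eq (F : ℝ × ℝ → E3) : dX F = fun p => (1 / 2 : ℝ) • (dXi F p + dEta F p) := by
  funext p
  rw [dX, dXi, dEta, ← map_add, ← map_smul]
  norm_num

theorem dY_eq (F : ℝ × ℝ → E3) : dY F = fun p => (1 / 2 : ℝ) • (dEta F p - dXi F p) := by
  funext p
  rw [dY, dXi, dEta, ← map_sub, ← map_smul]
  norm_num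

theorem dY_dX_eq (hF : AnalyticAt ℝ F p) :
    dY (dX F) p = (1 / 4 : ℝ) • (dEta (dEta F) p - dXi (dXi F) p) := by
  have h1 := hF.dXi.differentiableAt
  have h2 := hF.dEta.differentiableAt
  have e1 : dXi (dX F) p = (1 / 2 : ℝ) • (dXi (dXi F) p + dXi (dEta F) p) := by
    rw [dX_eq, ← dXi_add h1 h2]
    exact dXi_clm ((1 / 2 : ℝ) • ContinuousLinearMap.id ℝ E3) (h1.add h2)
  have e2 : dEta (dX F) p = (1 / 2 : ℝ) • (dEta (dXi F) p + dEta (dEta F) p) := by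
    rw [dX_eq, ← dEta_add h1 h2]
    exact dEta_clm ((1 / 2 : ℝ) • ContinuousLinearMap.id ℝ E3) (h1.add h2)
  rw [dY_eq]
  beta_reduce
  rw [e1, e2, dEta_dXi hF]
  module

theorem cross_dX_dY (F : ℝ × ℝ → E3) (p : ℝ × ℝ) :
    cross (dX F p) (dY F p) = (1 / 2 : ℝ) • cross (dXi F p) (dEta F p) := by
  rw [dX_eq, dY_eq]
  exact cross_half_add_sub _ _

theorem normalMap_eq (F : ℝ × ℝ → E3) (p : ℝ × ℝ) : normalMap F p =
    ‖cross (dXi F p) (dEta F p)‖⁻¹ • cross (dXi F p) (dEta F p) := by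
  rw [normalMap, cross_dX_dY, norm_smul, smul_smul, mul_inv]
  norm_num
  congr 1
  ring

end Coordinates

namespace Flat
variable {V W X : Type*} [NormedAddCommGroup V] [NormedSpace ℝ V] [CompleteSpace V]
  [NormedAddCommGroup W] [NormedSpace ℝ W] [CompleteSpace W]
  [NormedAddCommGroup X] [NormedSpace ℝ X] [CompleteSpace X]
  {S : Set (ℝ × ℝ)} {k : ℕ}

/-- Congruence modulo functions that are flat of order `k` is compatible with bilinear maps. -/
theorem bilin_sub (hS : IsOpen S) {B : V × W → X} (hB : IsBoundedBilinearMap ℝ B)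
    {H H' : ℝ × ℝ → V} {K K' : ℝ × ℝ → W} (aH : AnalyticOnNhd ℝ H S) (aH' : AnalyticOnNhd ℝ H' S)
    (aK : AnalyticOnNhd ℝ K S) (aK' : AnalyticOnNhd ℝ K' S)
    (hH : Flat S k (fun p => H p - H' p)) (hK : Flat S k (fun p => K p - K' p)) :
    Flat S k (fun p => B (H p, K p) - B (H' p, K' p)) := by
  refine congr hS (add hS ((aH.sub aH').bilin hB aK) (aH'.bilin hB (aK.sub aK'))
    (bilin_left hS hB (aH.sub aH') aK hH) (bilin_right hS hB aH' (aK.sub aK') hK)) fun p _ => ?_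
  have h1 : B (H p - H' p, K p) = B (H p, K p) - B (H' p, K p) :=
    hB.map_sub_left
  have h2 : B (H' p, K p - K' p) = B (H' p, K p) - B (H' p, K' p) :=
    hB.map_sub_right
  simp only [Pi.sub_apply]
  rw [h1, h2]
  abel

end Flat

/-! ### The partial differential equation of isothermic surfaces and uniqueness -/

section Uniqueness

/-- The partial differential equation of isothermic surfaces, solved for `F_ηη`, without
denominators. -/
def IsothermicPDE (F : ℝ × ℝ → E3) (p : ℝ × ℝ) : Prop :=
  ((inner ℝ (dXi F p) (dXi F p) : ℝ) * (inner ℝ (dXi F p) (dXi F p) : ℝ)) •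
    (dEta (dEta F) p + dXi (dXi F) p) =
  (inner ℝ (dXi (dXi F) p) (cross (dXi F p) (dEta F p)) : ℝ) •
    (cross (dXi F p) (dEta F p) + cross (dXi F p) (dEta F p))

/-- Uniqueness for the Cauchy problem of `IsothermicPDE`: modulo functions that are flat of order
`k`, the equation expresses `F_ηη` by `F_ξ`, `F_η` and `F_ξξ`, so flatness of `F - G` and of the
first derivatives of `F - G` improves by one order at a time. -/
theorem isothermicPDE_eqOn {F G : ℝ × ℝ → E3} {a b : ℝ}
    (aF : AnalyticOnNhd ℝ F (Box a b)) (aG : AnalyticOnNhd ℝ G (Box a b))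
    (hF : ∀ p ∈ Box a b, IsothermicPDE F p) (hG : ∀ p ∈ Box a b, IsothermicPDE G p)
    (hF0 : ∀ p ∈ Box a b, dXi F p ≠ 0)
    (h0 : ∀ ξ, (ξ, 0) ∈ Box a b → F (ξ, 0) = G (ξ, 0))
    (h1 : ∀ ξ, (ξ, 0) ∈ Box a b → dEta F (ξ, 0) = dEta G (ξ, 0)) : Set.EqOn F G (Box a b) := by
  have hS := isOpen_Box a b
  have hI := isBoundedBilinearMap_inner (𝕜 := ℝ) (E := E3)
  have aE : ∀ {F : ℝ × ℝ → E3}, AnalyticOnNhd ℝ F (Box a b) →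
      AnalyticOnNhd ℝ (fun p => (inner ℝ (dXi F p) (dXi F p) : ℝ)) (Box a b) := fun h =>
    h.dXi.bilin hI h.dXi
  have aE2 : ∀ {F : ℝ × ℝ → E3}, AnalyticOnNhd ℝ F (Box a b) → AnalyticOnNhd ℝ
      (fun p => (inner ℝ (dXi F p) (dXi F p) : ℝ) * (inner ℝ (dXi F p) (dXi F p) : ℝ))
      (Box a b) := fun h => (aE h).mul (aE h)
  have aν : ∀ {F : ℝ × ℝ → E3}, AnalyticOnNhd ℝ F (Box a b) →
      AnalyticOnNhd ℝ (fun p => cross (dXi F p) (dEta F p)) (Box a b) := fun h =>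
    h.dXi.bilin isBoundedBilinearMap_cross h.dEta
  have aI : ∀ {F : ℝ × ℝ → E3}, AnalyticOnNhd ℝ F (Box a b) → AnalyticOnNhd ℝ
      (fun p => (inner ℝ (dXi (dXi F) p) (cross (dXi F p) (dEta F p)) : ℝ)) (Box a b) := fun h =>
    h.dXi.dXi.bilin hI (aν h)
  have aw : ∀ {F : ℝ × ℝ → E3}, AnalyticOnNhd ℝ F (Box a b) → AnalyticOnNhd ℝ
      (fun p => dEta (dEta F) p + dXi (dXi F) p) (Box a b) := fun h =>
    h.dEta.dEta.add h.dXi.dXi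
  have aR : ∀ {F : ℝ × ℝ → E3}, AnalyticOnNhd ℝ F (Box a b) → AnalyticOnNhd ℝ
      (fun p => (inner ℝ (dXi (dXi F) p) (cross (dXi F p) (dEta F p)) : ℝ) •
        (cross (dXi F p) (dEta F p) + cross (dXi F p) (dEta F p))) (Box a b) := fun h =>
    (aI h).smul ((aν h).add (aν h))
  have key : ∀ k, Flat (Box a b) k (fun p => F p - G p) ∧
      Flat (Box a b) k (fun p => dXi F p - dXi G p) ∧
      Flat (Box a b) k (fun p => dEta F p - dEta G p) := by
    intro k
    induction k with
    | zero => exact ⟨trivial, trivial, trivial⟩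
    | succ k ih =>
      obtain ⟨i0, i1, i2⟩ := ih
      have dξ : Flat (Box a b) k (fun p => dXi (dXi F) p - dXi (dXi G) p) :=
        (i1.dXi hS (aF.dXi.sub aG.dXi)).congr hS fun p hp =>
          dXi_sub (aF.dXi p hp).differentiableAt (aG.dXi p hp).differentiableAt
      have dη : Flat (Box a b) k (fun p => dXi (dEta F) p - dXi (dEta G) p) :=
        (i2.dXi hS (aF.dEta.sub aG.dEta)).congr hS fun p hp =>
          dXi_sub (aF.dEta p hp).differentiableAt (aG.dEta p hp).differentiableAt
      have fE := Flat.bilin_sub hS hI aF.dXi aG.dXi aF.dXi aG.dXi i1 i1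
      have fE2 := Flat.bilin_sub hS isBoundedBilinearMap_mul (aE aF) (aE aG) (aE aF) (aE aG) fE fE
      have fν := Flat.bilin_sub hS isBoundedBilinearMap_cross aF.dXi aG.dXi aF.dEta aG.dEta i1 i2
      have fI := Flat.bilin_sub hS hI aF.dXi.dXi aG.dXi.dXi (aν aF) (aν aG)
        dξ fν
      have fν2 := (fν.add hS ((aν aF).sub (aν aG)) ((aν aF).sub (aν aG)) fν).congr hS
        (K := fun p => (cross (dXi F p) (dEta F p) + cross (dXi F p) (dEta F p)) -
          (cross (dXi G p) (dEta G p) + cross (dXi G p) (dEta G p))) fun p _ => by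
            simp only [Pi.sub_apply]; abel
      have fR := Flat.bilin_sub hS isBoundedBilinearMap_smul (aI aF) (aI aG)
        ((aν aF).add (aν aF)) ((aν aG).add (aν aG)) fI fν2
      have fEw := Flat.bilin_left hS isBoundedBilinearMap_smul ((aE2 aF).sub (aE2 aG)) (aw aG) fE2
      have fdiff := Flat.sub hS ((aR aF).sub (aR aG)) (((aE2 aF).sub (aE2 aG)).smul (aw aG)) fR fEw
      -- Division by `|F_ξ| ^ 4` is division by a nonvanishing analytic function.
      have ne : ∀ p ∈ Box a b, (inner ℝ (dXi F p) (dXi F p) : ℝ) *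
          (inner ℝ (dXi F p) (dXi F p) : ℝ) ≠ 0 := fun p hp =>
        mul_self_ne_zero.2 (inner_self_ne_zero.2 (hF0 p hp))
      have fw := (Flat.bilin_right hS isBoundedBilinearMap_smul ((aE2 aF).inv ne)
        (((aR aF).sub (aR aG)).sub (((aE2 aF).sub (aE2 aG)).smul (aw aG))) fdiff).congr hS
        (K := fun p => (dEta (dEta F) p + dXi (dXi F) p) - (dEta (dEta G) p + dXi (dXi G) p))
        fun p hp => by
          have e1 := hF p hp
          have e2 := hG p hp
          rw [IsothermicPDE] at e1 e2
          simp only [Pi.sub_apply, Pi.inv_apply]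
          beta_reduce
          rw [← e1, ← e2, inv_smul_eq_iff₀ (ne p hp)]
          module
      have fηη := (Flat.sub hS ((aw aF).sub (aw aG)) (aF.dXi.dXi.sub aG.dXi.dXi) fw dξ).congr hS
        (K := fun p => dEta (dEta F) p - dEta (dEta G) p) fun p hp => by
          simp only [Pi.sub_apply]; abel
      refine ⟨⟨fun ξ hξ => sub_eq_zero.2 (h0 ξ hξ), i2.congr hS fun p hp => ?_⟩,
        ⟨fun ξ hξ => ?_, dη.congr hS fun p hp => ?_⟩,
        ⟨fun ξ hξ => sub_eq_zero.2 (h1 ξ hξ), fηη.congr hS fun p hp => ?_⟩⟩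
      · exact (dEta_sub (aF p hp).differentiableAt (aG p hp).differentiableAt).symm
      · have z : Flat (Box a b) 1 (fun p => F p - G p) :=
          ⟨fun ξ hξ => sub_eq_zero.2 (h0 ξ hξ), trivial⟩
        have := (z.dXi hS (aF.sub aG)).1 ξ hξ
        rw [← this]
        exact (dXi_sub (aF _ hξ).differentiableAt (aG _ hξ).differentiableAt).symm
      · beta_reduce
        rw [← dEta_dXi (aF p hp), ← dEta_dXi (aG p hp)]
        exact (dEta_sub (aF.dXi p hp).differentiableAt (aG.dXi p hp).differentiableAt).symm
      · exact (dEta_sub (aF.dEta p hp).differentiableAt (aG.dEta p hp).differentiableAt).symm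
  intro p hp
  exact sub_eq_zero.1 (Flat.eqOn_zero (aF.sub aG) (fun k => (key k).1) p hp)

theorem norm_dX_sq (F : ℝ × ℝ → E3) (p : ℝ × ℝ) : ‖dX F p‖ ^ 2 = (1 / 4) *
    (inner ℝ (dXi F p) (dXi F p) + 2 * inner ℝ (dXi F p) (dEta F p) +
      inner ℝ (dEta F p) (dEta F p)) := by
  rw [dX_eq, ← real_inner_self_eq_norm_sq]
  simp only [inner_E3, PiLp.add_apply, PiLp.smul_apply, smul_eq_mul]
  ring

theorem norm_dY_sq (F : ℝ × ℝ → E3) (p : ℝ × ℝ) : ‖dY F p‖ ^ 2 = (1 / 4) *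
    (inner ℝ (dXi F p) (dXi F p) - 2 * inner ℝ (dXi F p) (dEta F p) +
      inner ℝ (dEta F p) (dEta F p)) := by
  rw [dY_eq, ← real_inner_self_eq_norm_sq]
  simp only [inner_E3, PiLp.sub_apply, PiLp.smul_apply, smul_eq_mul]
  ring

theorem inner_dX_dY (F : ℝ × ℝ → E3) (p : ℝ × ℝ) : inner ℝ (dX F p) (dY F p) = (1 / 4) *
    (inner ℝ (dEta F p) (dEta F p) - inner ℝ (dXi F p) (dXi F p)) := by
  rw [dX_eq, dY_eq]
  simp only [inner_E3, PiLp.add_apply, PiLp.sub_apply, PiLp.smul_apply, smul_eq_mul]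
  ring

/-- In the coordinates `(ξ, η)` the first fundamental form of an isothermic surface is conformal,
too. -/
theorem IsIsothermic.conformal_xi_eta {r h : ℝ} {F : ℝ × ℝ → E3} (hF : IsIsothermic r h F)
    {p : ℝ × ℝ} (hp : p ∈ Dom r h) : inner ℝ (dXi F p) (dEta F p) = 0 ∧
      inner ℝ (dEta F p) (dEta F p) = inner ℝ (dXi F p) (dXi F p) ∧ dXi F p ≠ 0 := by
  obtain ⟨u, hu⟩ := hF.conformal
  obtain ⟨h1, h2, h3⟩ := hu p hp
  have h4 := h1.trans h2.symm
  rw [norm_dX_sq, norm_dY_sq] at h4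
  rw [inner_dX_dY] at h3
  have h5 : inner ℝ (dXi F p) (dEta F p) = 0 := by linarith
  have h6 : inner ℝ (dEta F p) (dEta F p) = inner ℝ (dXi F p) (dXi F p) := by linarith
  refine ⟨h5, h6, fun h0 => ?_⟩
  rw [norm_dX_sq, h6, h0] at h1
  simp only [inner_zero_left] at h1
  linarith [Real.exp_pos (2 * u p)]

theorem dXi_inner {H K : ℝ × ℝ → E3} {p : ℝ × ℝ} (hH : DifferentiableAt ℝ H p)
    (hK : DifferentiableAt ℝ K p) : dXi (fun x => (inner ℝ (H x) (K x) : ℝ)) p =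
      inner ℝ (H p) (dXi K p) + inner ℝ (dXi H p) (K p) :=
  dXi_bilin (B := fun x : E3 × E3 => inner ℝ x.1 x.2) isBoundedBilinearMap_inner hH hK

theorem dEta_inner {H K : ℝ × ℝ → E3} {p : ℝ × ℝ} (hH : DifferentiableAt ℝ H p)
    (hK : DifferentiableAt ℝ K p) : dEta (fun x => (inner ℝ (H x) (K x) : ℝ)) p =
      inner ℝ (H p) (dEta K p) + inner ℝ (dEta H p) (K p) :=
  dEta_bilin (B := fun x : E3 × E3 => inner ℝ x.1 x.2) isBoundedBilinearMap_inner hH hK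

/-- Differentiation of the conformality relations shows that `F_ηη + F_ξξ` is normal to the
surface; its normal component is `2 ⟨F_ξξ, N⟩` since the coordinates `x, y` are conjugate. -/
theorem IsIsothermic.isothermicPDE {r h : ℝ} {F : ℝ × ℝ → E3} (hF : IsIsothermic r h F)
    {S : Set (ℝ × ℝ)} (hS : IsOpen S) (hSD : S ⊆ Dom r h) (aF : AnalyticOnNhd ℝ F S) {p : ℝ × ℝ}
    (hp : p ∈ S) : IsothermicPDE F p := by
  have d1 := (aF p hp).dXi.differentiableAt
  have d2 := (aF p hp).dEta.differentiableAt
  have nh := hS.mem_nhds hp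
  have e1 : (fun x => (inner ℝ (dXi F x) (dEta F x) : ℝ)) =ᶠ[nhds p] fun _ => 0 := by
    filter_upwards [nh] with q hq using (hF.conformal_xi_eta (hSD hq)).1
  have e2 : (fun x => (inner ℝ (dEta F x) (dEta F x) : ℝ)) =ᶠ[nhds p]
      fun x => inner ℝ (dXi F x) (dXi F x) := by
    filter_upwards [nh] with q hq using (hF.conformal_xi_eta (hSD hq)).2.1
  obtain ⟨c1, c2, c3⟩ := hF.conformal_xi_eta (hSD hp)
  have f1 := dXi_congr e1
  have f2 := dEta_congr e1
  have f3 := dXi_congr e2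
  have f4 := dEta_congr e2
  rw [dXi_const, dXi_inner d1 d2] at f1
  rw [dEta_const, dEta_inner d1 d2] at f2
  rw [dXi_inner d2 d2, dXi_inner d1 d1] at f3
  rw [dEta_inner d2 d2, dEta_inner d1 d1] at f4
  rw [dEta_dXi (aF p hp)] at f2 f4
  have cl := hF.curvatureLine p (hSD hp)
  rw [dY_dX_eq (aF p hp), normalMap_eq] at cl
  set a := dXi F p
  set b := dEta F p
  set aξ := dXi (dXi F) p
  set bξ := dXi (dEta F) p
  set bη := dEta (dEta F) p
  have hν : inner ℝ (cross a b) (cross a b) = inner ℝ a a * inner ℝ a a := by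
    rw [inner_cross_cross, c1, c2]; ring
  have hν0 : cross a b ≠ 0 := by
    rw [← inner_self_ne_zero (𝕜 := ℝ), hν]
    exact mul_self_ne_zero.2 (inner_self_ne_zero.2 c3)
  rw [inner_smul_left, inner_smul_right, inner_sub_left] at cl
  have cl' : inner ℝ bη (cross a b) = inner ℝ aξ (cross a b) := by
    have h1 : ‖cross a b‖⁻¹ ≠ 0 := inv_ne_zero (norm_ne_zero_iff.2 hν0)
    simpa [h1, sub_eq_zero] using cl
  have w1 : inner ℝ (bη + aξ) a = 0 := by
    rw [inner_add_left]
    linarith [real_inner_comm a bη, real_inner_comm a bξ, real_inner_comm a aξ,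
      real_inner_comm b bη, real_inner_comm b bξ, real_inner_comm b aξ]
  have w2 : inner ℝ (bη + aξ) b = 0 := by
    rw [inner_add_left]
    linarith [real_inner_comm a bη, real_inner_comm a bξ, real_inner_comm a aξ,
      real_inner_comm b bη, real_inner_comm b bξ, real_inner_comm b aξ]
  have := smul_eq_of_orthogonal w1 w2
  rw [hν, inner_add_left, cl'] at this
  rw [IsothermicPDE, this]
  module

/-- The Cauchy data of a solution determine `F_η` on the axis: `|F_ξ| ^ 2 F_η = |F_ξ| ^ 2 n × F_ξ`,
since `F_ξ × F_η = |F_ξ| ^ 2 N`. -/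
theorem IsIsothermic.smul_dEta {r h : ℝ} {F : ℝ × ℝ → E3} (hF : IsIsothermic r h F)
    {p : ℝ × ℝ} (hp : p ∈ Dom r h) : (inner ℝ (dXi F p) (dXi F p) : ℝ) • dEta F p =
      cross ((inner ℝ (dXi F p) (dXi F p) : ℝ) • normalMap F p) (dXi F p) := by
  obtain ⟨c1, c2, c3⟩ := hF.conformal_xi_eta hp
  have hn : ‖cross (dXi F p) (dEta F p)‖ = inner ℝ (dXi F p) (dXi F p) := by
    rw [← sq_eq_sq₀ (norm_nonneg _) real_inner_self_nonneg, ← real_inner_self_eq_norm_sq,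
      inner_cross_cross, c1, c2]
    ring
  have h0 : (inner ℝ (dXi F p) (dXi F p) : ℝ) ≠ 0 := inner_self_ne_zero.2 c3
  rw [normalMap_eq, hn, smul_inv_smul₀ h0, cross_cross_self, c1, zero_smul, sub_zero]

/-- Uniqueness, first on a box around the origin and then on `Dom r h` by the identity theorem. -/
theorem IsBjorlingSolution.eqOn {r h : ℝ} (h0 : 0 < h) (hr : h ≤ r) {f n : ℝ → E3}
    {F G : ℝ × ℝ → E3} (hF : IsBjorlingSolution r h f n F) (hG : IsBjorlingSolution r h f n G) :
    Set.EqOn F G (Dom r h) := by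
  have hsub : Box (h / 2) (h / 2) ⊆ Dom r h := by
    rintro ⟨ξ, η⟩ ⟨h1, h2⟩
    have h1' := abs_lt.2 h1
    have h2' := abs_lt.2 h2
    simp only at h1' h2' h2
    refine ⟨by simp only; linarith, by simp only; linarith [h2.1], by simp only; linarith [h2.2]⟩
  have hmem : ∀ {ξ : ℝ}, (ξ, (0 : ℝ)) ∈ Box (h / 2) (h / 2) → ξ ∈ Set.Ioo (-r) r := by
    rintro ξ ⟨h1, -⟩
    exact ⟨by linarith [h1.1], by linarith [h1.2]⟩
  have hS := isOpen_Box (h / 2) (h / 2)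
  have aF := hF.analytic.mono hsub
  have aG := hG.analytic.mono hsub
  have hξ : ∀ {F : ℝ × ℝ → E3}, IsBjorlingSolution r h f n F →
      ∀ ξ, (ξ, 0) ∈ Box (h / 2) (h / 2) → dXi F (ξ, 0) = deriv f ξ := fun {F} hF ξ hξ => by
    have h1 := hasDerivAt_xi (hF.analytic _ (hsub hξ)).differentiableAt
    refine (h1.congr_of_eventuallyEq ?_).deriv.symm
    filter_upwards [isOpen_Ioo.mem_nhds (hmem hξ)] with s hs using (hF.curve_eq s hs).symm
  have key : Set.EqOn F G (Box (h / 2) (h / 2)) := by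
    refine isothermicPDE_eqOn aF aG
      (fun p hp => hF.isothermic.isothermicPDE hS hsub aF hp)
      (fun p hp => hG.isothermic.isothermicPDE hS hsub aG hp)
      (fun p hp => (hF.isothermic.conformal_xi_eta (hsub hp)).2.2)
      (fun ξ hp => (hF.curve_eq ξ (hmem hp)).trans (hG.curve_eq ξ (hmem hp)).symm)
      (fun ξ hp => ?_)
    have e1 := hF.isothermic.smul_dEta (hsub hp)
    have e2 := hG.isothermic.smul_dEta (hsub hp)
    have ne := (hF.isothermic.conformal_xi_eta (hsub hp)).2.2
    rw [hξ hF ξ hp, hF.normal_eq ξ (hmem hp)] at e1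
    rw [hξ hG ξ hp, hG.normal_eq ξ (hmem hp)] at e2
    rw [hξ hF ξ hp] at ne
    exact smul_right_injective E3 (inner_self_ne_zero (𝕜 := ℝ).2 ne) (e1.trans e2.symm)
  have hconv : Convex ℝ (Dom r h) := by
    have c1 : Convex ℝ {p : ℝ × ℝ | |p.1| + |p.2| ≤ r} := by
      have := ((convexOn_norm (convex_univ (𝕜 := ℝ) (E := ℝ))).comp_linearMap
        (LinearMap.fst ℝ ℝ ℝ)).add ((convexOn_norm (convex_univ (𝕜 := ℝ) (E := ℝ))).comp_linearMap
        (LinearMap.snd ℝ ℝ ℝ))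
      simpa using this.convex_le r
    have c2 : Convex ℝ {p : ℝ × ℝ | p.2 ∈ Set.Ioc (-h) h} :=
      (convex_Ioc (-h) h).linear_preimage (LinearMap.snd ℝ ℝ ℝ)
    exact c1.inter c2
  have h00 : ((0, 0) : ℝ × ℝ) ∈ Box (h / 2) (h / 2) := by
    constructor <;> constructor <;> simp [h0]
  refine hF.analytic.eqOn_of_preconnected_of_eventuallyEq hG.analytic hconv.isPreconnected
    (hsub h00) ?_
  filter_upwards [hS.mem_nhds h00] with p hp using key hp

end Uniqueness

/-! ### The structure equations in the direction of `η` -/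

section Rules
variable {V : Type*} [NormedAddCommGroup V] [NormedSpace ℝ V]

theorem dXi_smul {c : ℝ × ℝ → ℝ} {H : ℝ × ℝ → V} {p : ℝ × ℝ} (hc : DifferentiableAt ℝ c p)
    (hH : DifferentiableAt ℝ H p) :
    dXi (fun x => c x • H x) p = c p • dXi H p + dXi c p • H p :=
  dXi_bilin isBoundedBilinearMap_smul hc hH

theorem dEta_smul {c : ℝ × ℝ → ℝ} {H : ℝ × ℝ → V} {p : ℝ × ℝ} (hc : DifferentiableAt ℝ c p)
    (hH : DifferentiableAt ℝ H p) :
    dEta (fun x => c x • H x) p = c p • dEta H p + dEta c p • H p :=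
  dEta_bilin isBoundedBilinearMap_smul hc hH

theorem dEta_cross {H K : ℝ × ℝ → E3} {p : ℝ × ℝ} (hH : DifferentiableAt ℝ H p)
    (hK : DifferentiableAt ℝ K p) :
    dEta (fun x => cross (H x) (K x)) p = cross (H p) (dEta K p) + cross (dEta H p) (K p) :=
  dEta_bilin isBoundedBilinearMap_cross hH hK

variable [CompleteSpace V] {a b : ℝ}

theorem eq_zero_of_dEta_eq_smul {c : ℝ × ℝ → ℝ} {T : ℝ × ℝ → V}
    (ac : AnalyticOnNhd ℝ c (Box a b)) (aT : AnalyticOnNhd ℝ T (Box a b))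
    (h0 : ∀ ξ, (ξ, 0) ∈ Box a b → T (ξ, 0) = 0)
    (h : ∀ p ∈ Box a b, dEta T p = c p • T p) : ∀ p ∈ Box a b, T p = 0 := by
  refine Flat.eqOn_zero aT fun k => ?_
  induction k with
  | zero => trivial
  | succ k ih =>
    exact ⟨h0, (Flat.bilin_right (isOpen_Box a b) isBoundedBilinearMap_smul ac aT ih).congr
      (isOpen_Box a b) fun p hp => (h p hp).symm⟩

/-- Uniqueness for the linear system that governs both the structure equations of a moving frame
and the deviation from them. -/
theorem eq_zero_of_skew_system {p l m : ℝ × ℝ → ℝ} {T₁ T₂ T₃ : ℝ × ℝ → V}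
    (ap : AnalyticOnNhd ℝ p (Box a b)) (al : AnalyticOnNhd ℝ l (Box a b))
    (am : AnalyticOnNhd ℝ m (Box a b)) (a1 : AnalyticOnNhd ℝ T₁ (Box a b))
    (a2 : AnalyticOnNhd ℝ T₂ (Box a b)) (a3 : AnalyticOnNhd ℝ T₃ (Box a b))
    (h0 : ∀ ξ, (ξ, 0) ∈ Box a b → T₁ (ξ, 0) = 0 ∧ T₂ (ξ, 0) = 0 ∧ T₃ (ξ, 0) = 0)
    (h1 : ∀ x ∈ Box a b, dEta T₁ x = p x • T₂ x + m x • T₃ x)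
    (h2 : ∀ x ∈ Box a b, dEta T₂ x = -(p x • T₁ x) + l x • T₃ x)
    (h3 : ∀ x ∈ Box a b, dEta T₃ x = -(m x • T₁ x) - l x • T₂ x) :
    ∀ x ∈ Box a b, T₁ x = 0 ∧ T₂ x = 0 ∧ T₃ x = 0 := by
  have hS := isOpen_Box a b
  have key : ∀ k, Flat (Box a b) k T₁ ∧ Flat (Box a b) k T₂ ∧ Flat (Box a b) k T₃ := by
    intro k
    induction k with
    | zero => exact ⟨trivial, trivial, trivial⟩
    | succ k ih =>
      obtain ⟨i1, i2, i3⟩ := ih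
      have sm : ∀ {c : ℝ × ℝ → ℝ} {T : ℝ × ℝ → V}, AnalyticOnNhd ℝ c (Box a b) →
          AnalyticOnNhd ℝ T (Box a b) → Flat (Box a b) k T →
          Flat (Box a b) k (fun x => c x • T x) := fun ac aT h =>
        Flat.bilin_right hS isBoundedBilinearMap_smul ac aT h
      refine ⟨⟨fun ξ hξ => (h0 ξ hξ).1, ?_⟩, ⟨fun ξ hξ => (h0 ξ hξ).2.1, ?_⟩,
        ⟨fun ξ hξ => (h0 ξ hξ).2.2, ?_⟩⟩
      · exact (Flat.add hS (ap.smul a2) (am.smul a3) (sm ap a2 i2) (sm am a3 i3)).congr hS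
          fun x hx => (h1 x hx).symm
      · exact (Flat.add hS (ap.smul a1).neg (al.smul a3) (Flat.neg hS (sm ap a1 i1))
          (sm al a3 i3)).congr hS fun x hx => (h2 x hx).symm
      · exact (Flat.sub hS (am.smul a1).neg (al.smul a2) (Flat.neg hS (sm am a1 i1))
          (sm al a2 i2)).congr hS fun x hx => (h3 x hx).symm
  exact fun x hx => ⟨Flat.eqOn_zero a1 (fun k => (key k).1) x hx,
    Flat.eqOn_zero a2 (fun k => (key k).2.1) x hx, Flat.eqOn_zero a3 (fun k => (key k).2.2) x hx⟩

end Rules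

section System

/-- The `η`-part of the structure equations of a surface `F` with conformal factor `g`
(with `k = 1 / g`), adapted orthonormal frame `e₁, e₂, N` and conformal connection form
`(p, q) = (log g)_ξ, (log g)_η`, for which `F_ξξ` and `F_ηη` have the same normal component.
The second fundamental form is `g * (l, m, l)`. In these unknowns the equations of
Gauss and Codazzi form a semilinear system with quadratic right hand sides. -/
structure IsStructureSystem (S : Set (ℝ × ℝ)) (F e₁ e₂ N : ℝ × ℝ → E3) (g k p q l m : ℝ × ℝ → ℝ) :
    Prop where
  an_F : AnalyticOnNhd ℝ F S
  an_e₁ : AnalyticOnNhd ℝ e₁ S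
  an_e₂ : AnalyticOnNhd ℝ e₂ S
  an_N : AnalyticOnNhd ℝ N S
  an_g : AnalyticOnNhd ℝ g S
  an_k : AnalyticOnNhd ℝ k S
  an_p : AnalyticOnNhd ℝ p S
  an_q : AnalyticOnNhd ℝ q S
  an_l : AnalyticOnNhd ℝ l S
  an_m : AnalyticOnNhd ℝ m S
  eq_F : ∀ x ∈ S, dEta F x = g x • e₂ x
  eq_e₁ : ∀ x ∈ S, dEta e₁ x = p x • e₂ x + m x • N x
  eq_e₂ : ∀ x ∈ S, dEta e₂ x = -(p x • e₁ x) + l x • N x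
  eq_N : ∀ x ∈ S, dEta N x = -(m x • e₁ x) - l x • e₂ x
  eq_g : ∀ x ∈ S, dEta g x = g x * q x
  eq_k : ∀ x ∈ S, dEta k x = -(k x * q x)
  eq_p : ∀ x ∈ S, dEta p x = dXi q x
  eq_q : ∀ x ∈ S, dEta q x = -dXi p x - (l x * l x - m x * m x)
  eq_l : ∀ x ∈ S, dEta l x = dXi m x + (m x * p x + l x * q x)
  eq_m : ∀ x ∈ S, dEta m x = dXi l x - (l x * p x + q x * m x)

/-- The state space of the system: the values of `(F, e₁, e₂, N, g, k, p, q, l, m)`. -/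
abbrev StateSpace : Type := E3 × E3 × E3 × E3 × ℝ × ℝ × ℝ × ℝ × ℝ × ℝ

/-- The linear part of the system. -/
def linPart : StateSpace →L[ℝ] StateSpace :=
  LinearMap.toContinuousLinearMap
    { toFun := fun ⟨_, _, _, _, _, _, p, q, l, m⟩ => (0, 0, 0, 0, 0, 0, q, -p, m, l)
      map_add' := by
        rintro ⟨_, _, _, _, _, _, p, q, l, m⟩ ⟨_, _, _, _, _, _, p', q', l', m'⟩
        simp [add_comm]
      map_smul' := by
        rintro c ⟨_, _, _, _, _, _, p, q, l, m⟩
        simp }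

/-- The quadratic part of the system, polarized. -/
def quadPart : StateSpace →L[ℝ] StateSpace →L[ℝ] StateSpace :=
  (LinearMap.mk₂ ℝ
    (fun (v w : StateSpace) =>
      match v, w with
      | ⟨_, _, _, _, g, k, p, q, l, m⟩, ⟨_, e₁, e₂, N, _, _, p', q', l', m'⟩ =>
        ((g • e₂, p • e₂ + m • N, -(p • e₁) + l • N, -(m • e₁) - l • e₂, g * q', -(k * q'), 0,
          -(l * l' - m * m'), m * p' + l * q', -(l * p' + q * m')) : StateSpace))
    (by
      rintro ⟨_, _, _, _, _⟩ ⟨_, _, _, _, _⟩ ⟨_, _, _, _, _⟩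
      simp only [Prod.mk_add_mk, Prod.mk.injEq]
      refine ⟨?_, ?_, ?_, ?_, ?_, ?_, ?_, ?_, ?_, ?_⟩ <;> first | module | ring)
    (by
      rintro c ⟨_, _, _, _, _⟩ ⟨_, _, _, _, _⟩
      simp only [Prod.smul_mk, Prod.mk.injEq, Prod.smul_fst, Prod.smul_snd, smul_eq_mul]
      refine ⟨?_, ?_, ?_, ?_, ?_, ?_, ?_, ?_, ?_, ?_⟩ <;> first | module | ring)
    (by
      rintro ⟨_, _, _, _, _⟩ ⟨_, _, _, _, _⟩ ⟨_, _, _, _, _⟩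
      simp only [Prod.mk_add_mk, Prod.mk.injEq]
      refine ⟨?_, ?_, ?_, ?_, ?_, ?_, ?_, ?_, ?_, ?_⟩ <;> first | module | ring)
    (by
      rintro c ⟨_, _, _, _, _⟩ ⟨_, _, _, _, _⟩
      simp only [Prod.smul_mk, Prod.mk.injEq, Prod.smul_fst, Prod.smul_snd, smul_eq_mul]
      refine ⟨?_, ?_, ?_, ?_, ?_, ?_, ?_, ?_, ?_, ?_⟩ <;> first | module | ring)
    ).toContinuousBilinearMap

section Product
variable {V W : Type*} [NormedAddCommGroup V] [NormedSpace ℝ V] [NormedAddCommGroup W]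
  [NormedSpace ℝ W] {H : ℝ × ℝ → V × W} {x : ℝ × ℝ}

theorem dXi_prod (h : DifferentiableAt ℝ H x) :
    dXi H x = (dXi (fun y => (H y).1) x, dXi (fun y => (H y).2) x) :=
  Prod.ext (dXi_clm (ContinuousLinearMap.fst ℝ V W) h).symm
    (dXi_clm (ContinuousLinearMap.snd ℝ V W) h).symm

theorem dEta_prod (h : DifferentiableAt ℝ H x) :
    dEta H x = (dEta (fun y => (H y).1) x, dEta (fun y => (H y).2) x) :=
  Prod.ext (dEta_clm (ContinuousLinearMap.fst ℝ V W) h).symm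
    (dEta_clm (ContinuousLinearMap.snd ℝ V W) h).symm

end Product

/-- The structure equations in the direction of `η` are solvable for arbitrary analytic Cauchy
data. -/
theorem exists_isStructureSystem {r : ℝ} {F₀ e₁₀ e₂₀ N₀ : ℝ → E3} {g₀ k₀ p₀ q₀ l₀ m₀ : ℝ → ℝ}
    (h1 : AnalyticOnNhd ℝ F₀ (Set.Icc (-r) r)) (h2 : AnalyticOnNhd ℝ e₁₀ (Set.Icc (-r) r))
    (h3 : AnalyticOnNhd ℝ e₂₀ (Set.Icc (-r) r)) (h4 : AnalyticOnNhd ℝ N₀ (Set.Icc (-r) r))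
    (h5 : AnalyticOnNhd ℝ g₀ (Set.Icc (-r) r)) (h6 : AnalyticOnNhd ℝ k₀ (Set.Icc (-r) r))
    (h7 : AnalyticOnNhd ℝ p₀ (Set.Icc (-r) r)) (h8 : AnalyticOnNhd ℝ q₀ (Set.Icc (-r) r))
    (h9 : AnalyticOnNhd ℝ l₀ (Set.Icc (-r) r)) (h10 : AnalyticOnNhd ℝ m₀ (Set.Icc (-r) r)) :
    ∃ b > 0, ∃ (F e₁ e₂ N : ℝ × ℝ → E3) (g k p q l m : ℝ × ℝ → ℝ),
      IsStructureSystem (Box r b) F e₁ e₂ N g k p q l m ∧ ∀ ξ ∈ Set.Ioo (-r) r,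
        (F (ξ, 0) = F₀ ξ ∧ e₁ (ξ, 0) = e₁₀ ξ ∧ e₂ (ξ, 0) = e₂₀ ξ ∧ N (ξ, 0) = N₀ ξ) ∧
        g (ξ, 0) = g₀ ξ ∧ k (ξ, 0) = k₀ ξ ∧ p (ξ, 0) = p₀ ξ ∧ q (ξ, 0) = q₀ ξ ∧
        l (ξ, 0) = l₀ ξ ∧ m (ξ, 0) = m₀ ξ := by
  obtain ⟨b, hb, u, hu, hu0, hpde⟩ := exists_analytic_solution linPart quadPart
    (u₀ := fun ξ => (F₀ ξ, e₁₀ ξ, e₂₀ ξ, N₀ ξ, g₀ ξ, k₀ ξ, p₀ ξ, q₀ ξ, l₀ ξ, m₀ ξ))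
    (h1.prod <| h2.prod <| h3.prod <| h4.prod <| h5.prod <| h6.prod <| h7.prod <|
      h8.prod <| h9.prod h10)
  have fs : ∀ {V W : Type} [NormedAddCommGroup V] [NormedSpace ℝ V] [NormedAddCommGroup W]
      [NormedSpace ℝ W] {H : ℝ × ℝ → V × W}, AnalyticOnNhd ℝ H (Box r b) →
      AnalyticOnNhd ℝ (fun x => (H x).1) (Box r b) :=
    fun {V W} _ _ _ _ {_} h => (ContinuousLinearMap.fst ℝ V W).comp_analyticOnNhd h
  have sn : ∀ {V W : Type} [NormedAddCommGroup V] [NormedSpace ℝ V] [NormedAddCommGroup W]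
      [NormedSpace ℝ W] {H : ℝ × ℝ → V × W}, AnalyticOnNhd ℝ H (Box r b) →
      AnalyticOnNhd ℝ (fun x => (H x).2) (Box r b) :=
    fun {V W} _ _ _ _ {_} h => (ContinuousLinearMap.snd ℝ V W).comp_analyticOnNhd h
  have a1 := sn hu
  have a2 := sn a1
  have a3 := sn a2
  have a4 := sn a3
  have a5 := sn a4
  have a6 := sn a5
  have a7 := sn a6
  have a8 := sn a7
  have key : ∀ x ∈ Box r b, _ := fun x hx => by
    have h := hpde x hx
    rw [dEta_prod (hu x hx).differentiableAt, dEta_prod (a1 x hx).differentiableAt,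
      dEta_prod (a2 x hx).differentiableAt, dEta_prod (a3 x hx).differentiableAt,
      dEta_prod (a4 x hx).differentiableAt, dEta_prod (a5 x hx).differentiableAt,
      dEta_prod (a6 x hx).differentiableAt, dEta_prod (a7 x hx).differentiableAt,
      dEta_prod (a8 x hx).differentiableAt,
      dXi_prod (hu x hx).differentiableAt, dXi_prod (a1 x hx).differentiableAt,
      dXi_prod (a2 x hx).differentiableAt, dXi_prod (a3 x hx).differentiableAt,
      dXi_prod (a4 x hx).differentiableAt, dXi_prod (a5 x hx).differentiableAt,
      dXi_prod (a6 x hx).differentiableAt, dXi_prod (a7 x hx).differentiableAt,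
      dXi_prod (a8 x hx).differentiableAt] at h
    simp only [linPart, quadPart, LinearMap.coe_toContinuousLinearMap', LinearMap.coe_mk,
      AddHom.coe_mk, LinearMap.toContinuousBilinearMap_apply, LinearMap.mk₂_apply,
      Prod.mk_add_mk, Prod.mk.injEq, zero_add] at h
    exact h
  refine ⟨b, hb, _, _, _, _, _, _, _, _, _, _,
    ⟨fs hu, fs a1, fs a2, fs a3, fs a4, fs a5, fs a6, fs a7, fs a8, sn a8,
      fun x hx => (key x hx).1, fun x hx => (key x hx).2.1, fun x hx => (key x hx).2.2.1,
      fun x hx => (key x hx).2.2.2.1, fun x hx => (key x hx).2.2.2.2.1,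
      fun x hx => (key x hx).2.2.2.2.2.1, fun x hx => ?_, fun x hx => ?_,
      fun x hx => (key x hx).2.2.2.2.2.2.2.2.1, fun x hx => ?_⟩, fun ξ hξ => ?_⟩
  · rw [(key x hx).2.2.2.2.2.2.1, add_zero]
  · rw [(key x hx).2.2.2.2.2.2.2.1, ← sub_eq_add_neg]
  · rw [(key x hx).2.2.2.2.2.2.2.2.2, ← sub_eq_add_neg]
  · simp [hu0 ξ hξ]

end System

/-! ### Propagation of the structure equations -/

namespace IsStructureSystem
variable {a b : ℝ} {F e₁ e₂ N : ℝ × ℝ → E3} {g k p q l m : ℝ × ℝ → ℝ}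

/-- A frame that is positively oriented and orthonormal on the axis is so everywhere. -/
theorem cross_eq (hs : IsStructureSystem (Box a b) F e₁ e₂ N g k p q l m)
    (h0 : ∀ ξ, (ξ, 0) ∈ Box a b → cross (e₂ (ξ, 0)) (N (ξ, 0)) = e₁ (ξ, 0) ∧
      cross (N (ξ, 0)) (e₁ (ξ, 0)) = e₂ (ξ, 0) ∧ cross (e₁ (ξ, 0)) (e₂ (ξ, 0)) = N (ξ, 0)) :
    ∀ x ∈ Box a b, cross (e₂ x) (N x) = e₁ x ∧ cross (N x) (e₁ x) = e₂ x ∧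
      cross (e₁ x) (e₂ x) = N x := by
  have hB := isBoundedBilinearMap_cross
  have key := eq_zero_of_skew_system (T₁ := fun x => cross (e₂ x) (N x) - e₁ x)
    (T₂ := fun x => cross (N x) (e₁ x) - e₂ x) (T₃ := fun x => cross (e₁ x) (e₂ x) - N x)
    hs.an_p hs.an_l hs.an_m ((hs.an_e₂.bilin hB hs.an_N).sub hs.an_e₁)
    ((hs.an_N.bilin hB hs.an_e₁).sub hs.an_e₂) ((hs.an_e₁.bilin hB hs.an_e₂).sub hs.an_N)
    (fun ξ hξ => by simpa only [sub_eq_zero] using h0 ξ hξ) ?_ ?_ ?_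
  · simpa only [sub_eq_zero] using key
  all_goals
    intro x hx
    have d1 := (hs.an_e₁ x hx).differentiableAt
    have d2 := (hs.an_e₂ x hx).differentiableAt
    have d3 := (hs.an_N x hx).differentiableAt
  · rw [dEta_sub ((hs.an_e₂.bilin hB hs.an_N) x hx).differentiableAt d1, dEta_cross d2 d3,
      hs.eq_e₁ x hx, hs.eq_e₂ x hx, hs.eq_N x hx]
    apply E3_ext <;>
    · simp only [cross_apply_zero, cross_apply_one, cross_apply_two, PiLp.add_apply,
        PiLp.sub_apply, PiLp.neg_apply, PiLp.smul_apply, smul_eq_mul]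
      ring
  · rw [dEta_sub ((hs.an_N.bilin hB hs.an_e₁) x hx).differentiableAt d2, dEta_cross d3 d1,
      hs.eq_e₁ x hx, hs.eq_e₂ x hx, hs.eq_N x hx]
    apply E3_ext <;>
    · simp only [cross_apply_zero, cross_apply_one, cross_apply_two, PiLp.add_apply,
        PiLp.sub_apply, PiLp.neg_apply, PiLp.smul_apply, smul_eq_mul]
      ring
  · rw [dEta_sub ((hs.an_e₁.bilin hB hs.an_e₂) x hx).differentiableAt d3, dEta_cross d1 d2,
      hs.eq_e₁ x hx, hs.eq_e₂ x hx, hs.eq_N x hx]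
    apply E3_ext <;>
    · simp only [cross_apply_zero, cross_apply_one, cross_apply_two, PiLp.add_apply,
        PiLp.sub_apply, PiLp.neg_apply, PiLp.smul_apply, smul_eq_mul]
      ring

theorem inner_N_self (hs : IsStructureSystem (Box a b) F e₁ e₂ N g k p q l m)
    (hc : ∀ x ∈ Box a b, cross (e₁ x) (e₂ x) = N x)
    (h0 : ∀ ξ, (ξ, 0) ∈ Box a b → inner ℝ (N (ξ, 0)) (N (ξ, 0)) = (1 : ℝ)) :
    ∀ x ∈ Box a b, inner ℝ (N x) (N x) = (1 : ℝ) := by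
  have hI := isBoundedBilinearMap_inner (𝕜 := ℝ) (E := E3)
  have aN : AnalyticOnNhd ℝ (fun x => (inner ℝ (N x) (N x) : ℝ)) (Box a b) :=
    hs.an_N.bilin hI hs.an_N
  have key := eq_zero_of_dEta_eq_smul (c := fun _ => 0) (T := fun x => inner ℝ (N x) (N x) - (1 : ℝ))
    (analyticOnNhd_const) (aN.sub analyticOnNhd_const) (fun ξ hξ => sub_eq_zero.2 (h0 ξ hξ)) ?_
  · exact fun x hx => sub_eq_zero.1 (key x hx)
  · intro x hx
    have d := (hs.an_N x hx).differentiableAt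
    have o1 : inner ℝ (N x) (e₁ x) = (0 : ℝ) := by
      rw [← hc x hx]; exact inner_cross_self_left _ _
    have o2 : inner ℝ (N x) (e₂ x) = (0 : ℝ) := by
      rw [← hc x hx]; exact inner_cross_self_right _ _
    rw [dEta_sub (aN x hx).differentiableAt (differentiableAt_const _), dEta_inner d d,
      hs.eq_N x hx, dEta_const]
    have o1' := (real_inner_comm (N x) (e₁ x)).trans o1
    have o2' := (real_inner_comm (N x) (e₂ x)).trans o2
    simp [inner_sub_right, inner_sub_left, inner_neg_right, inner_neg_left, inner_smul_right,
      inner_smul_left, o1, o2, o1', o2']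

/-- The unknown `k` stays the inverse of `g`, so the conformal factor does not vanish. -/
theorem g_mul_k (hs : IsStructureSystem (Box a b) F e₁ e₂ N g k p q l m)
    (h0 : ∀ ξ, (ξ, 0) ∈ Box a b → g (ξ, 0) * k (ξ, 0) = 1) :
    ∀ x ∈ Box a b, g x * k x = 1 := by
  have key := eq_zero_of_dEta_eq_smul (c := fun _ => 0) (T := fun x => g x * k x - 1)
    (analyticOnNhd_const) ((hs.an_g.mul hs.an_k).sub analyticOnNhd_const)
    (fun ξ hξ => sub_eq_zero.2 (h0 ξ hξ)) ?_
  · exact fun x hx => sub_eq_zero.1 (key x hx)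
  · intro x hx
    have d1 := (hs.an_g x hx).differentiableAt
    have d2 := (hs.an_k x hx).differentiableAt
    have e : dEta (fun x => g x * k x) x = g x * dEta k x + dEta g x * k x := dEta_smul d1 d2
    rw [dEta_sub (d1.fun_mul d2) (differentiableAt_const _), e, hs.eq_g x hx, hs.eq_k x hx, dEta_const]
    rw [zero_smul]
    ring

/-- The `ξ`-part of the structure equations of the frame propagates from the axis; this is where
the equations of Gauss and Codazzi enter. -/
theorem dXi_frame (hs : IsStructureSystem (Box a b) F e₁ e₂ N g k p q l m)
    (h0 : ∀ ξ, (ξ, 0) ∈ Box a b →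
      dXi e₁ (ξ, 0) = -(q (ξ, 0) • e₂ (ξ, 0)) + l (ξ, 0) • N (ξ, 0) ∧
      dXi e₂ (ξ, 0) = q (ξ, 0) • e₁ (ξ, 0) + m (ξ, 0) • N (ξ, 0) ∧
      dXi N (ξ, 0) = -(l (ξ, 0) • e₁ (ξ, 0)) - m (ξ, 0) • e₂ (ξ, 0)) :
    ∀ x ∈ Box a b, dXi e₁ x = -(q x • e₂ x) + l x • N x ∧
      dXi e₂ x = q x • e₁ x + m x • N x ∧ dXi N x = -(l x • e₁ x) - m x • e₂ x := by
  have key := eq_zero_of_skew_system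
    (T₁ := fun x => dXi e₁ x - (-(q x • e₂ x) + l x • N x))
    (T₂ := fun x => dXi e₂ x - (q x • e₁ x + m x • N x))
    (T₃ := fun x => dXi N x - (-(l x • e₁ x) - m x • e₂ x))
    hs.an_p hs.an_l hs.an_m
    (hs.an_e₁.dXi.sub ((hs.an_q.smul hs.an_e₂).neg.add (hs.an_l.smul hs.an_N)))
    (hs.an_e₂.dXi.sub ((hs.an_q.smul hs.an_e₁).add (hs.an_m.smul hs.an_N)))
    (hs.an_N.dXi.sub ((hs.an_l.smul hs.an_e₁).neg.sub (hs.an_m.smul hs.an_e₂)))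
    (fun ξ hξ => by simpa only [sub_eq_zero] using h0 ξ hξ) ?_ ?_ ?_
  · simpa only [sub_eq_zero] using key
  all_goals
    intro x hx
    have nh := (isOpen_Box a b).mem_nhds hx
    have d1 := (hs.an_e₁ x hx).differentiableAt
    have d2 := (hs.an_e₂ x hx).differentiableAt
    have d3 := (hs.an_N x hx).differentiableAt
    have dp := (hs.an_p x hx).differentiableAt
    have dq := (hs.an_q x hx).differentiableAt
    have dl := (hs.an_l x hx).differentiableAt
    have dm := (hs.an_m x hx).differentiableAt
  · have e : dXi (dEta e₁) x = (p x • dXi e₂ x + dXi p x • e₂ x) +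
        (m x • dXi N x + dXi m x • N x) := by
      rw [← dXi_smul dp d2, ← dXi_smul dm d3, ← dXi_add (dp.fun_smul d2) (dm.fun_smul d3)]
      exact dXi_congr (by filter_upwards [nh] with y hy using hs.eq_e₁ y hy)
    rw [dEta_sub (hs.an_e₁ x hx).dXi.differentiableAt ((dq.fun_smul d2).fun_neg.fun_add (dl.fun_smul d3)),
      dEta_add (dq.fun_smul d2).fun_neg (dl.fun_smul d3), dEta_neg, dEta_smul dq d2, dEta_smul dl d3,
      dEta_dXi (hs.an_e₁ x hx), e, hs.eq_e₂ x hx, hs.eq_N x hx, hs.eq_q x hx, hs.eq_l x hx]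
    module
  · have e : dXi (dEta e₂) x = -(p x • dXi e₁ x + dXi p x • e₁ x) +
        (l x • dXi N x + dXi l x • N x) := by
      rw [← dXi_smul dp d1, ← dXi_smul dl d3, ← dXi_neg, ← dXi_add (dp.fun_smul d1).fun_neg (dl.fun_smul d3)]
      exact dXi_congr (by filter_upwards [nh] with y hy using hs.eq_e₂ y hy)
    rw [dEta_sub (hs.an_e₂ x hx).dXi.differentiableAt ((dq.fun_smul d1).fun_add (dm.fun_smul d3)),
      dEta_add (dq.fun_smul d1) (dm.fun_smul d3), dEta_smul dq d1, dEta_smul dm d3,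
      dEta_dXi (hs.an_e₂ x hx), e, hs.eq_e₁ x hx, hs.eq_N x hx, hs.eq_q x hx, hs.eq_m x hx]
    module
  · have e : dXi (dEta N) x = -(m x • dXi e₁ x + dXi m x • e₁ x) -
        (l x • dXi e₂ x + dXi l x • e₂ x) := by
      rw [← dXi_smul dm d1, ← dXi_smul dl d2, ← dXi_neg, ← dXi_sub (dm.fun_smul d1).fun_neg (dl.fun_smul d2)]
      exact dXi_congr (by filter_upwards [nh] with y hy using hs.eq_N y hy)
    rw [dEta_sub (hs.an_N x hx).dXi.differentiableAt ((dl.fun_smul d1).fun_neg.fun_sub (dm.fun_smul d2)),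
      dEta_sub (dl.fun_smul d1).fun_neg (dm.fun_smul d2), dEta_neg, dEta_smul dl d1, dEta_smul dm d2,
      dEta_dXi (hs.an_N x hx), e, hs.eq_e₁ x hx, hs.eq_e₂ x hx, hs.eq_m x hx, hs.eq_l x hx]
    module

theorem dXi_g (hs : IsStructureSystem (Box a b) F e₁ e₂ N g k p q l m)
    (h0 : ∀ ξ, (ξ, 0) ∈ Box a b → dXi g (ξ, 0) = g (ξ, 0) * p (ξ, 0)) :
    ∀ x ∈ Box a b, dXi g x = g x * p x := by
  have key := eq_zero_of_dEta_eq_smul (T := fun x => dXi g x - g x * p x) hs.an_q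
    (hs.an_g.dXi.sub (hs.an_g.mul hs.an_p)) (fun ξ hξ => sub_eq_zero.2 (h0 ξ hξ)) ?_
  · exact fun x hx => sub_eq_zero.1 (key x hx)
  · intro x hx
    have dg := (hs.an_g x hx).differentiableAt
    have dp := (hs.an_p x hx).differentiableAt
    have dq := (hs.an_q x hx).differentiableAt
    have e : dXi (dEta g) x = g x * dXi q x + dXi g x * q x := by
      rw [dXi_congr (K := fun y => g y • q y)
        (by filter_upwards [(isOpen_Box a b).mem_nhds hx] with y hy using hs.eq_g y hy),
        dXi_smul dg dq]
      rfl
    have e' : dEta (fun x => g x * p x) x = g x * dEta p x + dEta g x * p x := dEta_smul dg dp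
    rw [dEta_sub (hs.an_g x hx).dXi.differentiableAt (dg.fun_mul dp), dEta_dXi (hs.an_g x hx), e, e',
      hs.eq_p x hx, hs.eq_g x hx, smul_eq_mul]
    ring

theorem dXi_F (hs : IsStructureSystem (Box a b) F e₁ e₂ N g k p q l m)
    (hg : ∀ x ∈ Box a b, dXi g x = g x * p x)
    (he₂ : ∀ x ∈ Box a b, dXi e₂ x = q x • e₁ x + m x • N x)
    (h0 : ∀ ξ, (ξ, 0) ∈ Box a b → dXi F (ξ, 0) = g (ξ, 0) • e₁ (ξ, 0)) :
    ∀ x ∈ Box a b, dXi F x = g x • e₁ x := by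
  have key := eq_zero_of_dEta_eq_smul (c := fun _ => 0) (T := fun x => dXi F x - g x • e₁ x)
    analyticOnNhd_const (hs.an_F.dXi.sub (hs.an_g.smul hs.an_e₁))
    (fun ξ hξ => sub_eq_zero.2 (h0 ξ hξ)) ?_
  · exact fun x hx => sub_eq_zero.1 (key x hx)
  · intro x hx
    have dg := (hs.an_g x hx).differentiableAt
    have d1 := (hs.an_e₁ x hx).differentiableAt
    have d2 := (hs.an_e₂ x hx).differentiableAt
    have e : dXi (dEta F) x = g x • dXi e₂ x + dXi g x • e₂ x := by
      rw [← dXi_smul dg d2]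
      exact dXi_congr (by filter_upwards [(isOpen_Box a b).mem_nhds hx] with y hy using hs.eq_F y hy)
    rw [dEta_sub (hs.an_F x hx).dXi.differentiableAt (dg.fun_smul d1), dEta_dXi (hs.an_F x hx), e,
      dEta_smul dg d1, hg x hx, he₂ x hx, hs.eq_e₁ x hx, hs.eq_g x hx]
    module

end IsStructureSystem

/-- A surface with `F_ξ = g e₁`, `F_η = g e₂` for an orthonormal frame `e₁, e₂, N`, for which
`F_ξξ` and `F_ηη` have the same normal component, is isothermic. -/
theorem isIsothermic_of_frame {r h : ℝ} {F e₁ e₂ N : ℝ × ℝ → E3} {g p q l : ℝ × ℝ → ℝ}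
    {S : Set (ℝ × ℝ)} (hS : IsOpen S) (hSD : Dom r h ⊆ S) (aF : AnalyticOnNhd ℝ F S)
    (ag : AnalyticOnNhd ℝ g S) (a1 : AnalyticOnNhd ℝ e₁ S) (a2 : AnalyticOnNhd ℝ e₂ S)
    (hg : ∀ x ∈ S, g x ≠ 0)
    (hc : ∀ x ∈ S, cross (e₂ x) (N x) = e₁ x ∧ cross (N x) (e₁ x) = e₂ x ∧
      cross (e₁ x) (e₂ x) = N x)
    (hN : ∀ x ∈ S, inner ℝ (N x) (N x) = (1 : ℝ))
    (hξ : ∀ x ∈ S, dXi F x = g x • e₁ x) (hη : ∀ x ∈ S, dEta F x = g x • e₂ x)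
    (h1 : ∀ x ∈ S, dXi e₁ x = -(q x • e₂ x) + l x • N x)
    (h2 : ∀ x ∈ S, dEta e₂ x = -(p x • e₁ x) + l x • N x) :
    IsIsothermic r h F ∧ ∀ x ∈ Dom r h, normalMap F x = N x := by
  have o12 : ∀ x ∈ S, inner ℝ (e₁ x) (e₂ x) = (0 : ℝ) := fun x hx => by
    rw [real_inner_comm, ← (hc x hx).2.1]; exact inner_cross_self_right _ _
  have oN1 : ∀ x ∈ S, inner ℝ (e₁ x) (N x) = (0 : ℝ) := fun x hx => by
    rw [real_inner_comm, ← (hc x hx).2.2]; exact inner_cross_self_left _ _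
  have oN2 : ∀ x ∈ S, inner ℝ (e₂ x) (N x) = (0 : ℝ) := fun x hx => by
    rw [real_inner_comm, ← (hc x hx).2.2]; exact inner_cross_self_right _ _
  have n12 : ∀ x ∈ S, inner ℝ (e₁ x) (e₁ x) = (1 : ℝ) ∧ inner ℝ (e₂ x) (e₂ x) = (1 : ℝ) :=
    fun x hx => by
      have e := inner_cross_cross (e₂ x) (N x)
      rw [(hc x hx).1, oN2 x hx, hN x hx] at e
      have e' := inner_cross_cross (e₁ x) (e₂ x)
      rw [(hc x hx).2.2, o12 x hx, hN x hx] at e'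
      have p1 : (0 : ℝ) ≤ inner ℝ (e₁ x) (e₁ x) := real_inner_self_nonneg
      have p2 : (0 : ℝ) ≤ inner ℝ (e₂ x) (e₂ x) := real_inner_self_nonneg
      constructor <;> nlinarith
  have nX : ∀ x ∈ S, ‖dX F x‖ ^ 2 = g x ^ 2 / 2 := fun x hx => by
    rw [norm_dX_sq, hξ x hx, hη x hx]
    simp only [inner_smul_left, inner_smul_right, o12 x hx, n12 x hx]
    simp only [conj_trivial]
    ring
  have nY : ∀ x ∈ S, ‖dY F x‖ ^ 2 = g x ^ 2 / 2 := fun x hx => by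
    rw [norm_dY_sq, hξ x hx, hη x hx]
    simp only [inner_smul_left, inner_smul_right, o12 x hx, n12 x hx]
    simp only [conj_trivial]
    ring
  have gpos : ∀ x ∈ S, 0 < g x ^ 2 / 2 := fun x hx => by have := hg x hx; positivity
  have hnormal : ∀ x ∈ S, normalMap F x = N x := fun x hx => by
    have hN1 : ‖N x‖ = 1 := by
      rw [← sq_eq_sq₀ (norm_nonneg _) zero_le_one, ← real_inner_self_eq_norm_sq, hN x hx, one_pow]
    have hgg : g x * g x ≠ 0 := mul_self_ne_zero.2 (hg x hx)
    rw [normalMap_eq, hξ x hx, hη x hx, cross_smul_smul, (hc x hx).2.2, norm_smul, hN1, mul_one,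
      Real.norm_of_nonneg (mul_self_nonneg _), inv_smul_smul₀ hgg]
  refine ⟨⟨⟨fun x hx => (aF x (hSD hx)).contDiffAt, fun x hx h0 => ?_, fun x hx h0 => ?_⟩,
    ⟨fun x => Real.log (g x ^ 2 / 2) / 2, fun x hx => ?_⟩, fun x hx => ?_⟩,
    fun x hx => hnormal x (hSD hx)⟩
  · have := nX x (hSD hx)
    rw [h0, norm_zero] at this
    linarith [gpos x (hSD hx)]
  · have := nY x (hSD hx)
    rw [h0, norm_zero] at this
    linarith [gpos x (hSD hx)]
  · have hx' := hSD hx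
    rw [mul_div_cancel₀ _ two_ne_zero, Real.exp_log (gpos x hx')]
    refine ⟨nX x hx', nY x hx', ?_⟩
    rw [inner_dX_dY, hξ x hx', hη x hx']
    simp only [inner_smul_left, inner_smul_right, n12 x hx', sub_self, mul_zero]
  · have hx' := hSD hx
    have nh := hS.mem_nhds hx'
    have dg := (ag x hx').differentiableAt
    have e1 : dXi (dXi F) x = g x • dXi e₁ x + dXi g x • e₁ x := by
      rw [← dXi_smul dg (a1 x hx').differentiableAt]
      exact dXi_congr (by filter_upwards [nh] with y hy using hξ y hy)
    have e2 : dEta (dEta F) x = g x • dEta e₂ x + dEta g x • e₂ x := by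
      rw [← dEta_smul dg (a2 x hx').differentiableAt]
      exact dEta_congr (by filter_upwards [nh] with y hy using hη y hy)
    rw [hnormal x hx', dY_dX_eq (aF x hx'), e1, e2, h1 x hx', h2 x hx']
    simp only [inner_smul_left, inner_add_left, inner_sub_left, inner_neg_left, oN1 x hx',
      oN2 x hx', hN x hx']
    simp

/-! ### Cauchy data and existence -/

section Main

theorem exists_Icc_subset_of_isOpen {O : Set ℝ} (hO : IsOpen O) {r : ℝ} (hr : 0 < r)
    (h : Set.Icc (-r) r ⊆ O) : ∃ r' > r, Set.Icc (-r') r' ⊆ O := by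
  obtain ⟨δ, hδ, hsub⟩ := isCompact_Icc.exists_cthickening_subset_open hO h
  refine ⟨r + δ, by linarith, fun x hx => hsub ?_⟩
  refine Metric.mem_cthickening_of_dist_le x (max (-r) (min x r)) δ _
    ⟨le_max_left _ _, max_le (by linarith) (min_le_right _ _)⟩ ?_
  rw [Real.dist_eq, abs_le]
  obtain ⟨h1, h2⟩ := hx
  rcases le_total x r with h3 | h3
  · rw [min_eq_left h3]
    rcases le_total (-r) x with h4 | h4
    · rw [max_eq_right h4]; constructor <;> linarith
    · rw [max_eq_left h4]; constructor <;> linarith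
  · rw [min_eq_right h3, max_eq_right (by linarith)]
    constructor <;> linarith

/-- Expansion of a vector in a positively oriented orthonormal frame. -/
theorem eq_sum_inner_smul {e₁ e₂ n : E3} (hc : cross e₁ e₂ = n) (h12 : inner ℝ e₁ e₂ = (0 : ℝ))
    (h1 : inner ℝ e₁ e₁ = (1 : ℝ)) (h2 : inner ℝ e₂ e₂ = (1 : ℝ)) (hn : inner ℝ n n = (1 : ℝ))
    (v : E3) : v = (inner ℝ v e₁ : ℝ) • e₁ + (inner ℝ v e₂ : ℝ) • e₂ + (inner ℝ v n : ℝ) • n := by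
  have h21 : inner ℝ e₂ e₁ = (0 : ℝ) := (real_inner_comm e₁ e₂).trans h12
  have hn1 : inner ℝ e₁ n = (0 : ℝ) := by
    rw [real_inner_comm, ← hc]; exact inner_cross_self_left _ _
  have hn2 : inner ℝ e₂ n = (0 : ℝ) := by
    rw [real_inner_comm, ← hc]; exact inner_cross_self_right _ _
  have key := smul_eq_of_orthogonal (a := e₁) (b := e₂)
    (w := v - (inner ℝ v e₁ : ℝ) • e₁ - (inner ℝ v e₂ : ℝ) • e₂)
    (by rw [inner_sub_left, inner_sub_left, inner_smul_left, inner_smul_left, h1, h21]; simp)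
    (by rw [inner_sub_left, inner_sub_left, inner_smul_left, inner_smul_left, h2, h12]; simp)
  rw [hc, hn, one_smul, inner_sub_left, inner_sub_left, inner_smul_left, inner_smul_left, hn1, hn2,
    mul_zero, mul_zero, sub_zero, sub_zero] at key
  rw [← key]
  abel

/-- The derivatives of an orthonormal frame field along a curve. -/
theorem deriv_frame {e₁ e₂ n : ℝ → E3} {s : Set ℝ} (hs : IsOpen s)
    (d1 : ∀ x ∈ s, DifferentiableAt ℝ e₁ x) (d2 : ∀ x ∈ s, DifferentiableAt ℝ e₂ x)
    (dn : ∀ x ∈ s, DifferentiableAt ℝ n x) (hc : ∀ x ∈ s, cross (e₁ x) (e₂ x) = n x)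
    (h12 : ∀ x ∈ s, inner ℝ (e₁ x) (e₂ x) = (0 : ℝ)) (h1 : ∀ x ∈ s, inner ℝ (e₁ x) (e₁ x) = (1 : ℝ))
    (h2 : ∀ x ∈ s, inner ℝ (e₂ x) (e₂ x) = (1 : ℝ)) (hn : ∀ x ∈ s, inner ℝ (n x) (n x) = (1 : ℝ))
    {x : ℝ} (hx : x ∈ s) {q l m : ℝ} (hq : q = -inner ℝ (deriv e₁ x) (e₂ x))
    (hl : l = inner ℝ (deriv e₁ x) (n x)) (hm : m = inner ℝ (deriv e₂ x) (n x)) :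
    deriv e₁ x = -(q • e₂ x) + l • n x ∧ deriv e₂ x = q • e₁ x + m • n x ∧
      deriv n x = -(l • e₁ x) - m • e₂ x := by
  have hn1 : ∀ x ∈ s, inner ℝ (e₁ x) (n x) = (0 : ℝ) := fun x hx => by
    rw [real_inner_comm, ← hc x hx]; exact inner_cross_self_left _ _
  have hn2 : ∀ x ∈ s, inner ℝ (e₂ x) (n x) = (0 : ℝ) := fun x hx => by
    rw [real_inner_comm, ← hc x hx]; exact inner_cross_self_right _ _
  have D : ∀ {a b : ℝ → E3} {c : ℝ}, DifferentiableAt ℝ a x → DifferentiableAt ℝ b x →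
      (∀ x ∈ s, inner ℝ (a x) (b x) = c) →
      inner ℝ (a x) (deriv b x) + inner ℝ (deriv a x) (b x) = (0 : ℝ) := by
    intro a b c ha hb h
    refine (ha.hasDerivAt.inner ℝ hb.hasDerivAt).unique
      ((hasDerivAt_const x c).congr_of_eventuallyEq ?_)
    filter_upwards [hs.mem_nhds hx] with y hy using h y hy
  have t1 := D (d1 x hx) (d1 x hx) h1
  have t2 := D (d2 x hx) (d2 x hx) h2
  have t3 := D (dn x hx) (dn x hx) hn
  have t4 := D (d1 x hx) (d2 x hx) h12
  have t5 := D (d1 x hx) (dn x hx) hn1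
  have t6 := D (d2 x hx) (dn x hx) hn2
  have E := eq_sum_inner_smul (hc x hx) (h12 x hx) (h1 x hx) (h2 x hx) (hn x hx)
  have c1 := real_inner_comm (e₁ x) (deriv e₁ x)
  have c2 := real_inner_comm (e₂ x) (deriv e₂ x)
  have c3 := real_inner_comm (n x) (deriv n x)
  have c4 := real_inner_comm (e₁ x) (deriv e₂ x)
  have c5 := real_inner_comm (e₁ x) (deriv n x)
  have c6 := real_inner_comm (e₂ x) (deriv n x)
  refine ⟨(E (deriv e₁ x)).trans ?_, (E (deriv e₂ x)).trans ?_, (E (deriv n x)).trans ?_⟩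
  · rw [show inner ℝ (deriv e₁ x) (e₁ x) = (0 : ℝ) by linarith,
      show inner ℝ (deriv e₁ x) (e₂ x) = -q by linarith, ← hl]
    module
  · rw [show inner ℝ (deriv e₂ x) (e₁ x) = q by linarith,
      show inner ℝ (deriv e₂ x) (e₂ x) = (0 : ℝ) by linarith, ← hm]
    module
  · rw [show inner ℝ (deriv n x) (e₁ x) = -l by linarith,
      show inner ℝ (deriv n x) (e₂ x) = -m by linarith,
      show inner ℝ (deriv n x) (n x) = (0 : ℝ) by linarith]
    module

theorem AnalyticOnNhd.norm_E3 {f : ℝ → E3} {s : Set ℝ} (hf : AnalyticOnNhd ℝ f s)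
    (h0 : ∀ x ∈ s, f x ≠ 0) : AnalyticOnNhd ℝ (fun x => ‖f x‖) s := fun x hx =>
  ((contDiffAt_norm ℝ (h0 x hx)).comp x ((hf x hx).contDiffAt (n := ω))).analyticAt

/-- Existence: the first component of the solution of the structure equations whose Cauchy data are
the frame `f' / |f'|`, `n × f' / |f'|`, `n` along the curve and its connection coefficients. -/
theorem exists_isBjorlingSolution {r : ℝ} (hr : 0 < r) {f n : ℝ → E3}
    (hf : AnalyticOnNhd ℝ f (Set.Icc (-r) r)) (hn : AnalyticOnNhd ℝ n (Set.Icc (-r) r))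
    (hreg : ∀ ξ ∈ Set.Icc (-r) r, deriv f ξ ≠ 0) (hunit : ∀ ξ ∈ Set.Icc (-r) r, ‖n ξ‖ = 1)
    (hnormal : ∀ ξ ∈ Set.Icc (-r) r, inner ℝ (deriv f ξ) (n ξ) = 0) :
    ∃ h : ℝ, 0 < h ∧ h ≤ r ∧ ∃ F : ℝ × ℝ → E3, IsBjorlingSolution r h f n F := by
  have hI := isBoundedBilinearMap_inner (𝕜 := ℝ) (E := E3)
  have hB := isBoundedBilinearMap_cross
  -- The data extend to a slightly larger interval, on which the conditions on them persist by the
  -- identity theorem.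
  obtain ⟨s, hs, hsub⟩ : ∃ s > r, Set.Icc (-s) s ⊆
      {x | AnalyticAt ℝ f x ∧ AnalyticAt ℝ n x ∧ deriv f x ≠ 0} := by
    refine exists_Icc_subset_of_isOpen ?_ hr fun x hx => ⟨hf x hx, hn x hx, hreg x hx⟩
    rw [isOpen_iff_mem_nhds]
    rintro x ⟨h1, h2, h3⟩
    filter_upwards [h1.eventually_analyticAt, h2.eventually_analyticAt,
      h1.deriv.continuousAt.eventually_ne h3] with y a1 a2 a3 using ⟨a1, a2, a3⟩
  have hs0 : 0 < s := hr.trans hs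
  have af : AnalyticOnNhd ℝ f (Set.Icc (-s) s) := fun x hx => (hsub hx).1
  have an : AnalyticOnNhd ℝ n (Set.Icc (-s) s) := fun x hx => (hsub hx).2.1
  have ne : ∀ x ∈ Set.Icc (-s) s, deriv f x ≠ 0 := fun x hx => (hsub hx).2.2
  have adf : AnalyticOnNhd ℝ (deriv f) (Set.Icc (-s) s) := fun x hx => (af x hx).deriv
  have h0s : (0 : ℝ) ∈ Set.Icc (-s) s := ⟨by linarith, by linarith⟩
  have near : ∀ᶠ x in nhds (0 : ℝ), x ∈ Set.Icc (-r) r :=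
    Icc_mem_nhds (by linarith) hr
  have unit : ∀ x ∈ Set.Icc (-s) s, inner ℝ (n x) (n x) = (1 : ℝ) := fun x hx =>
    AnalyticOnNhd.eqOn_of_preconnected_of_eventuallyEq (f := fun x => (inner ℝ (n x) (n x) : ℝ))
      (g := fun _ => 1) (an.bilin hI an) analyticOnNhd_const isPreconnected_Icc h0s (by
        filter_upwards [near] with y hy
        rw [real_inner_self_eq_norm_sq, hunit y hy, one_pow]) hx
  have normal : ∀ x ∈ Set.Icc (-s) s, inner ℝ (deriv f x) (n x) = (0 : ℝ) := fun x hx =>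
    AnalyticOnNhd.eqOn_of_preconnected_of_eventuallyEq
      (f := fun x => (inner ℝ (deriv f x) (n x) : ℝ))
      (g := fun _ => 0) (adf.bilin hI an) analyticOnNhd_const isPreconnected_Icc h0s (by
        filter_upwards [near] with y hy using hnormal y hy) hx
  -- The Cauchy data of the moving frame.
  have ne' : ∀ x ∈ Set.Icc (-s) s, ‖deriv f x‖ ≠ 0 := fun x hx => norm_ne_zero_iff.2 (ne x hx)
  set g₀ : ℝ → ℝ := fun x => ‖deriv f x‖ with hg₀
  set k₀ : ℝ → ℝ := fun x => (g₀ x)⁻¹ with hk₀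
  set t : ℝ → E3 := fun x => k₀ x • deriv f x with ht
  set w : ℝ → E3 := fun x => cross (n x) (t x) with hw
  have ag : AnalyticOnNhd ℝ g₀ (Set.Icc (-s) s) := adf.norm_E3 ne
  have ak : AnalyticOnNhd ℝ k₀ (Set.Icc (-s) s) := ag.inv ne'
  have at' : AnalyticOnNhd ℝ t (Set.Icc (-s) s) := ak.smul adf
  have aw : AnalyticOnNhd ℝ w (Set.Icc (-s) s) := an.bilin hB at'
  have adg : AnalyticOnNhd ℝ (deriv g₀) (Set.Icc (-s) s) := fun x hx => (ag x hx).deriv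
  have adt : AnalyticOnNhd ℝ (deriv t) (Set.Icc (-s) s) := fun x hx => (at' x hx).deriv
  have adw : AnalyticOnNhd ℝ (deriv w) (Set.Icc (-s) s) := fun x hx => (aw x hx).deriv
  have gt : ∀ x ∈ Set.Icc (-s) s, deriv f x = g₀ x • t x := fun x hx => by
    rw [ht, hk₀]; exact (smul_inv_smul₀ (ne' x hx) _).symm
  have tt : ∀ x ∈ Set.Icc (-s) s, inner ℝ (t x) (t x) = (1 : ℝ) := fun x hx => by
    have := ne' x hx
    simp only [ht, hk₀, hg₀, inner_smul_left, inner_smul_right, real_inner_self_eq_norm_sq,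
      conj_trivial]
    field_simp
  have tn : ∀ x ∈ Set.Icc (-s) s, inner ℝ (t x) (n x) = (0 : ℝ) := fun x hx => by
    simp only [ht, inner_smul_left, normal x hx, mul_zero]
  have nt : ∀ x ∈ Set.Icc (-s) s, inner ℝ (n x) (t x) = (0 : ℝ) := fun x hx =>
    (real_inner_comm (t x) (n x)).trans (tn x hx)
  have tw : ∀ x ∈ Set.Icc (-s) s, inner ℝ (t x) (w x) = (0 : ℝ) := fun x hx => by
    rw [real_inner_comm]; exact inner_cross_self_right _ _
  have ww : ∀ x ∈ Set.Icc (-s) s, inner ℝ (w x) (w x) = (1 : ℝ) := fun x hx => by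
    rw [hw]; beta_reduce; rw [inner_cross_cross, unit x hx, tt x hx, nt x hx]; norm_num
  have c1 : ∀ x ∈ Set.Icc (-s) s, cross (w x) (n x) = t x := fun x hx => by
    rw [hw]; beta_reduce
    rw [cross_cross_self, unit x hx, nt x hx, one_smul, zero_smul, sub_zero]
  have c3 : ∀ x ∈ Set.Icc (-s) s, cross (t x) (w x) = n x := fun x hx => by
    have anti : cross (t x) (w x) = cross (cross (t x) (n x)) (t x) := by
      rw [hw]
      apply E3_ext <;>
      · simp only [cross_apply_zero, cross_apply_one, cross_apply_two]
        ring
    rw [anti, cross_cross_self, tt x hx, tn x hx, one_smul, zero_smul, sub_zero]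
  obtain ⟨b, hb, F, e₁, e₂, N, g, k, p, q, l, m, sys, init⟩ := exists_isStructureSystem
    (p₀ := fun x => k₀ x * deriv g₀ x) (q₀ := fun x => -inner ℝ (deriv t x) (w x))
    (l₀ := fun x => inner ℝ (deriv t x) (n x)) (m₀ := fun x => inner ℝ (deriv w x) (n x))
    af at' aw an ag ak (ak.mul adg) (adt.bilin hI aw).neg (adt.bilin hI an) (adw.bilin hI an)
  have mem : ∀ {ξ : ℝ}, (ξ, (0 : ℝ)) ∈ Box s b → ξ ∈ Set.Ioo (-s) s := fun h => h.1
  have mem' : ∀ {ξ : ℝ}, (ξ, (0 : ℝ)) ∈ Box s b → ξ ∈ Set.Icc (-s) s := fun h =>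
    Set.Ioo_subset_Icc_self h.1
  -- The `ξ`-derivatives on the axis are those of the Cauchy data.
  have dax : ∀ {V : Type} [NormedAddCommGroup V] [NormedSpace ℝ V] {H : ℝ × ℝ → V} {H₀ : ℝ → V},
      AnalyticOnNhd ℝ H (Box s b) → (∀ ξ ∈ Set.Ioo (-s) s, H (ξ, 0) = H₀ ξ) →
      ∀ {ξ}, (ξ, 0) ∈ Box s b → dXi H (ξ, 0) = deriv H₀ ξ := by
    intro V _ _ H H₀ hH h ξ hξ
    refine ((hasDerivAt_xi (hH _ hξ).differentiableAt).congr_of_eventuallyEq ?_).deriv.symm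
    filter_upwards [isOpen_Ioo.mem_nhds (mem hξ)] with y hy using (h y hy).symm
  have cross_all := sys.cross_eq fun ξ hξ => by
    obtain ⟨⟨-, i1, i2, i3⟩, -⟩ := init ξ (mem hξ)
    rw [i1, i2, i3]
    exact ⟨c1 ξ (mem' hξ), rfl, c3 ξ (mem' hξ)⟩
  have NN := sys.inner_N_self (fun x hx => (cross_all x hx).2.2) fun ξ hξ => by
    rw [(init ξ (mem hξ)).1.2.2.2]; exact unit ξ (mem' hξ)
  have gk := sys.g_mul_k fun ξ hξ => by
    rw [(init ξ (mem hξ)).2.1, (init ξ (mem hξ)).2.2.1]; exact mul_inv_cancel₀ (ne' ξ (mem' hξ))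
  have frame := sys.dXi_frame fun ξ hξ => by
    obtain ⟨⟨-, i1, i2, i3⟩, -, -, -, i4, i5, i6⟩ := init ξ (mem hξ)
    rw [dax sys.an_e₁ (fun y hy => (init y hy).1.2.1) hξ,
      dax sys.an_e₂ (fun y hy => (init y hy).1.2.2.1) hξ,
      dax sys.an_N (fun y hy => (init y hy).1.2.2.2) hξ, i1, i2, i3]
    have J := Set.Ioo_subset_Icc_self (a := -s) (b := s)
    exact deriv_frame isOpen_Ioo (fun x hx => (at' x (J hx)).differentiableAt)
      (fun x hx => (aw x (J hx)).differentiableAt) (fun x hx => (an x (J hx)).differentiableAt)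
      (fun x hx => c3 x (J hx)) (fun x hx => tw x (J hx)) (fun x hx => tt x (J hx))
      (fun x hx => ww x (J hx)) (fun x hx => unit x (J hx)) (mem hξ) i4 i5 i6
  have dg := sys.dXi_g fun ξ hξ => by
    rw [dax sys.an_g (fun y hy => (init y hy).2.1) hξ, (init ξ (mem hξ)).2.1,
      (init ξ (mem hξ)).2.2.2.1]
    exact (mul_inv_cancel_left₀ (ne' ξ (mem' hξ)) _).symm
  have dF := sys.dXi_F dg (fun x hx => (frame x hx).2.1) fun ξ hξ => by
    rw [dax sys.an_F (fun y hy => (init y hy).1.1) hξ, (init ξ (mem hξ)).2.1,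
      (init ξ (mem hξ)).1.2.1]
    exact gt ξ (mem' hξ)
  -- `b / 2` and not `b`, since the edge `η = h` belongs to `Dom r h`.
  have hdom : Dom r (min r (b / 2)) ⊆ Box s b := by
    rintro ⟨ξ, η⟩ ⟨h1, h2, h3⟩
    simp only at h1 h2 h3
    have h4 : |ξ| < s := by linarith [abs_nonneg η]
    have h5 : min r (b / 2) ≤ b / 2 := min_le_right _ _
    exact ⟨abs_lt.1 h4, by constructor <;> simp only <;> linarith⟩
  obtain ⟨iso, nor⟩ := isIsothermic_of_frame (isOpen_Box s b) hdom sys.an_F sys.an_g sys.an_e₁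
    sys.an_e₂ (fun x hx h0 => by have := gk x hx; rw [h0, zero_mul] at this; exact zero_ne_one this)
    cross_all NN dF sys.eq_F (fun x hx => (frame x hx).1) sys.eq_e₂
  have axis : ∀ ξ ∈ Set.Ioo (-r) r, (ξ, (0 : ℝ)) ∈ Dom r (min r (b / 2)) := fun ξ hξ => by
    have : 0 < min r (b / 2) := by positivity
    exact ⟨by simpa using (abs_lt.2 hξ).le, by simpa using this, this.le⟩
  refine ⟨min r (b / 2), by positivity, min_le_left _ _, F, sys.an_F.mono hdom, iso,
    fun ξ hξ => ?_, fun ξ hξ => ?_⟩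
  · exact (init ξ (mem (hdom (axis ξ hξ)))).1.1
  · rw [nor _ (axis ξ hξ)]
    exact (init ξ (mem (hdom (axis ξ hξ)))).1.2.2.2

end Main

end

theorem theorem2p1 (r : ℝ) (hr : 0 < r) (f n : ℝ → E3)
    (hf : AnalyticOnNhd ℝ f (Set.Icc (-r) r))
    (hn : AnalyticOnNhd ℝ n (Set.Icc (-r) r))
    (hreg : ∀ ξ ∈ Set.Icc (-r) r, deriv f ξ ≠ 0)
    (hunit : ∀ ξ ∈ Set.Icc (-r) r, ‖n ξ‖ = 1)
    (hnormal : ∀ ξ ∈ Set.Icc (-r) r, inner ℝ (deriv f ξ) (n ξ) = 0) :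
    ∃ h : ℝ, 0 < h ∧ h ≤ r ∧
      (∃ F : ℝ × ℝ → E3, IsBjorlingSolution r h f n F) ∧
      (∀ F G : ℝ × ℝ → E3, IsBjorlingSolution r h f n F → IsBjorlingSolution r h f n G →
        Set.EqOn F G (Dom r h)) := by
  obtain ⟨h, h0, hle, hF⟩ := exists_isBjorlingSolution hr hf hn hreg hunit hnormal
  exact ⟨h, h0, hle, hF, fun F G hF hG => hF.eqOn h0 hle hG⟩
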